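/- **Setting.** Let $\pi_\Theta$ be a probability distribution on $\mathbb R$ with finite moments of all orders. For each $n$, let $\theta=(\theta_1,\dots,\theta_n)$ have i.i.d. coordinates of law $\pi_\Theta$, and let $Z\in\mathbb R^{n\times n}$ be a symmetric random matrix, independent of $\theta$, whose entries $(Z_{ij})_{i\le j}$ are independent with $Z_{ii}\sim N(0,2)$ and $Z_{ij}\sim N(0,1)$ for $i<j$. Put $$Y=\tfrac1{\sqrt n}\,\theta\theta^{\mathsf T}+Z .$$ Fix an integer $d\ge 0$ and, for each $t\ge 0$, a polynomial map $F_t:\mathbb R^d\to\mathbb R^d$; neither depends on $n$. Define vectors in $\mathbb R^d$ by $m^0_{i\to j}=0$, $m^0_i=0$, $m^t_{i\to i}=0$ and, for $t\ge 0$, $$m^{t+1}_{i\to j}=\frac1{\sqrt n}\sum_{k\in[n]\setminus\{i,j\}}Y_{ik}\,F_t(m^t_{k\to i})\quad(i\ne j),\qquad m^{t+1}_i=\frac1{\sqrt n}\sum_{k\in[n]\setminus\{i\}}Y_{ik}\,F_t(m^t_{k\to i}).$$ Define $\mu_t\in\mathbb R^d$ and $\Sigma_t\in\mathbb R^{d\times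 d}$ by $(\mu_0,\Sigma_0)=(0,0)$ and $$\mu_{t+1}=\mathbb E\{\Theta F_t(\mu_t\Theta+G_t)\},\qquad \Sigma_{t+1}=\mathbb E\{F_t(\mu_t\Theta+G_t)F_t(\mu_t\Theta+G_t)^{\mathsf T}\},\qquad (\Theta,G_t)\sim\pi_\Theta\otimes N(0,\Sigma_t).$$ **Lemma.** Every $\Sigma_t$ is positive semidefinite, and for every $t\ge0$ and every polynomial $\psi:\mathbb R^d\times\mathbb R\to\mathbb R$ the following holds, where $(\Theta,G_t)\sim\pi_\Theta\otimes N(0,\Sigma_t)$ and all the expectations below (for $n\ge 2$) exist and are finite: $$\lim_{n\to\infty}\mathbb E[\psi(m^t_{1\to2},\theta_1)]=\lim_{n\to\infty}\mathbb E[\psi(m^t_1,\theta_1)]=\mathbb E\,\psi(\mu_t\Theta+G_t,\Theta),$$ $$\lim_{n\to\infty}\mathbb E[\psi(F_t(m^t_1),\theta_1)]=\mathbb E\,\psi(F_t(\mu_t\Theta+G_t),\Theta),$$ $$\lim_{n\to\infty}\mathbb E[\psi(F_t(m^{t+1}_1),\theta_1)]=\mathbb E\,\psi(F_t(\mu_{t+1}\Theta+G_{t+1}),\Theta),$$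 with $(\Theta,G_{t+1})\sim\pi_\Theta\otimes N(0,\Sigma_{t+1})$ in the last line. -/

import Mathlib

open MeasureTheory ProbabilityTheory Filter Topology

noncomputable section

/-- The rank-one observation `Y = θ θᵀ / √n + Z`. The noise is given by its entries on unordered
pairs `s(i, j)` (diagonal pairs included), so that `Z i j = W s(i, j)` is a symmetric matrix. -/
def rankOneObs {n : ℕ} (θ : Fin n → ℝ) (W : Sym2 (Fin n) → ℝ) : Matrix (Fin n) (Fin n) ℝ :=
  Matrix.of fun i j => θ i * θ j / √(n : ℝ) + W s(i, j)

/-- The GOE noise: independent centred Gaussian entries on unordered pairs, of variance `2` on the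
diagonal and `1` off the diagonal. -/
def goeLaw (n : ℕ) : Measure (Sym2 (Fin n) → ℝ) :=
  Measure.pi fun e => gaussianReal 0 (if e.IsDiag then 2 else 1)

/-- Joint law of signal and noise: `θ` has i.i.d. coordinates of law `π`, and is independent of
the GOE noise. -/
def rankOneLaw (π : Measure ℝ) (n : ℕ) : Measure ((Fin n → ℝ) × (Sym2 (Fin n) → ℝ)) :=
  (Measure.pi fun _ => π).prod (goeLaw n)

/-- The map `ℝᵈ → ℝᵈ` whose coordinates are the given polynomials. -/
def polyMap {d : ℕ} (f : Fin d → MvPolynomial (Fin d) ℝ) (x : Fin d → ℝ) : Fin d → ℝ :=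
  fun a => MvPolynomial.eval x (f a)

/-- A polynomial test function `ψ : ℝᵈ × ℝ → ℝ`, evaluated at `(x, θ)`. -/
def testEval {d : ℕ} (ψ : MvPolynomial (Fin d ⊕ Unit) ℝ) (x : Fin d → ℝ) (θ : ℝ) : ℝ :=
  MvPolynomial.eval (Sum.elim x fun _ => θ) ψ

/-- The messages `m^t_{i → j}`, with `m^t_{i → i} = 0`. -/
def edgeMsg {d n : ℕ} (F : ℕ → Fin d → MvPolynomial (Fin d) ℝ) (Y : Matrix (Fin n) (Fin n) ℝ) :
    ℕ → Fin n → Fin n → Fin d → ℝ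
  | 0, _, _ => 0
  | t + 1, i, j =>
      if i = j then 0
      else (1 / √(n : ℝ)) • ∑ k ∈ Finset.univ \ {i, j}, Y i k • polyMap (F t) (edgeMsg F Y t k i)

/-- The vectors `m^t_i`, with `m^0_i = 0`. -/
def nodeMsg {d n : ℕ} (F : ℕ → Fin d → MvPolynomial (Fin d) ℝ) (Y : Matrix (Fin n) (Fin n) ℝ) :
    ℕ → Fin n → Fin d → ℝ
  | 0, _ => 0
  | t + 1, i =>
      (1 / √(n : ℝ)) • ∑ k ∈ Finset.univ \ {i}, Y i k • polyMap (F t) (edgeMsg F Y t k i)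

/-- State evolution `(μ_t, Σ_t)`, started at `(0, 0)`:
`μ_{t+1} = E[Θ F_t(μ_t Θ + G_t)]` and `Σ_{t+1} = E[F_t(μ_t Θ + G_t) F_t(μ_t Θ + G_t)ᵀ]`,
where `(Θ, G_t) ∼ π ⊗ N(0, Σ_t)`. -/
def stateEvolution {d : ℕ} (π : Measure ℝ) (F : ℕ → Fin d → MvPolynomial (Fin d) ℝ) :
    ℕ → (Fin d → ℝ) × Matrix (Fin d) (Fin d) ℝ
  | 0 => (0, 0)
  | t + 1 =>
      let μ := (stateEvolution π F t).1
      let S := (stateEvolution π F t).2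
      (fun a => ∫ p, p.1 * polyMap (F t) (fun i => μ i * p.1 + p.2 i) a
          ∂(π.prod (multivariateGaussian 0 S)),
        Matrix.of fun a b => ∫ p, polyMap (F t) (fun i => μ i * p.1 + p.2 i) a *
            polyMap (F t) (fun i => μ i * p.1 + p.2 i) b ∂(π.prod (multivariateGaussian 0 S)))

/-- The mean direction `μ_t`. -/
def seMean {d : ℕ} (π : Measure ℝ) (F : ℕ → Fin d → MvPolynomial (Fin d) ℝ) (t : ℕ) :
    Fin d → ℝ := (stateEvolution π F t).1

/-- The covariance `Σ_t`. -/
def seCov {d : ℕ} (π : Measure ℝ) (F : ℕ → Fin d → MvPolynomial (Fin d) ℝ) (t : ℕ) :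
    Matrix (Fin d) (Fin d) ℝ := (stateEvolution π F t).2

/-- The law `π ⊗ N(0, Σ_t)` of `(Θ, G_t)`. -/
def seLaw {d : ℕ} (π : Measure ℝ) (F : ℕ → Fin d → MvPolynomial (Fin d) ℝ) (t : ℕ) :
    Measure (ℝ × EuclideanSpace ℝ (Fin d)) :=
  π.prod (multivariateGaussian 0 (seCov π F t))

/-- The random vector `μ_t Θ + G_t`, as a function of `p = (Θ, G_t)`. -/
def seVec {d : ℕ} (π : Measure ℝ) (F : ℕ → Fin d → MvPolynomial (Fin d) ℝ) (t : ℕ)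
    (p : ℝ × EuclideanSpace ℝ (Fin d)) : Fin d → ℝ :=
  fun i => seMean π F t i * p.1 + p.2 i

/-- The expectations of `X n` under `P n` and of `L` under `Q` exist, and `E[X n] → E[L]`. -/
def ExpectationTendsto {Ω : ℕ → Type} [∀ n, MeasurableSpace (Ω n)] {Ω' : Type}
    [MeasurableSpace Ω'] (P : ∀ n, Measure (Ω n)) (X : ∀ n, Ω n → ℝ)
    (Q : Measure Ω') (L : Ω' → ℝ) : Prop :=
  (∀ n, Integrable (X n) (P n)) ∧ Integrable L Q ∧
    Tendsto (fun n => ∫ ω, X n ω ∂(P n)) atTop (𝓝 (∫ p, L p ∂Q))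

end

noncomputable section

open scoped Pointwise

/-! ### Polynomials in the signal and noise variables -/

/-! The messages are polynomials in signal and noise variables, and one linear functional `E` serves
every dimension. It is positive and normalised, has product moments for two distinct signals, and
satisfies Gaussian integration by parts in off-diagonal noise; diagonal noise never enters a
message. The law of `(μΘ + G, Θ)` is determined on polynomials by the moments of `Θ` and Stein's
identity `E[X_α φ] = μ_α E[Θ φ] + ∑_β Σ_αβ E[∂_β φ]`. It therefore suffices that messages satisfy
this identity up to `o(1)`. It is proved in the presence of a test polynomial of a second message
with another source, which also gives asymptotic independence (`ApproxStein.pairLimit`).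

Integrate by parts the noise part of `m_{a→b} = n⁻¹ ∑ θ_a θ_k F(m_{k→a}) + n^{-1/2} ∑ X_{ak}
F(m_{k→a})`. The signal part produces the empirical average of `θ_k F_α`, and the derivative of the
explicit factor `X_{ak}` in the message produces that of `F_α F_β`; everything else is error
(`expect_msgPoly_mul`). The two averages concentrate by a second moment computation, since messages
from distinct sources at the previous time are asymptotically independent
(`PairLimit.avgConcentrates`). This closes an induction on time, and the limits of the averages are
exactly the state evolution recursion.

The errors are controlled by derivative bounds: each edge derivative of a message costs `n^{-1/2}`,
and a further `n^{-1/2}` is gained when no differentiated edge enters the message directly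
(`WeightBdd.msgStep`). The delicate point is that `n^{-1/2} ∑_c X_{ac} y_c` stays bounded in every
moment, although the triangle inequality loses a factor `√n`. This too is integration by parts,
applied to powers of the sum (`SmoothBdd.momentBdd_noiseSum`).

A node message differs from an edge message by a single term of order `n^{-1/2}`, so both have the
same limits. -/

/-- Polynomials in signal variables indexed by `ℕ` and noise variables indexed by edges. -/
abbrev NoisePoly := MvPolynomial (ℕ ⊕ Sym2 ℕ) ℝ

/-- The signal variable `θ_i`. -/
def sigVar (i : ℕ) : NoisePoly := MvPolynomial.X (Sum.inl i)

/-- The noise variable of an edge. -/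
def noiVar (e : Sym2 ℕ) : NoisePoly := MvPolynomial.X (Sum.inr e)

/-- Differentiation in the noise variable of an edge. -/
def edgeDeriv (e : Sym2 ℕ) : Derivation ℝ NoisePoly NoisePoly := MvPolynomial.pderiv (Sum.inr e)

lemma edgeDeriv_sigVar (e : Sym2 ℕ) (i : ℕ) : edgeDeriv e (sigVar i) = 0 :=
  MvPolynomial.pderiv_X_of_ne (by simp)

lemma edgeDeriv_noiVar_self (e : Sym2 ℕ) : edgeDeriv e (noiVar e) = 1 :=
  MvPolynomial.pderiv_X_self _

lemma edgeDeriv_noiVar_of_ne {e e' : Sym2 ℕ} (h : e' ≠ e) : edgeDeriv e (noiVar e') = 0 :=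
  MvPolynomial.pderiv_X_of_ne (by simpa using h)

lemma edgeDeriv_mul (e : Sym2 ℕ) (f g : NoisePoly) :
    edgeDeriv e (f * g) = edgeDeriv e f * g + f * edgeDeriv e g := by
  rw [Derivation.leibniz]; simp only [smul_eq_mul]; ring

/-- The commutator of two derivations is a derivation, and this one vanishes on the variables. -/
lemma edgeDeriv_comm (e e' : Sym2 ℕ) (f : NoisePoly) :
    edgeDeriv e (edgeDeriv e' f) = edgeDeriv e' (edgeDeriv e f) := by
  have : ⁅edgeDeriv e, edgeDeriv e'⁆ = 0 := by
    apply MvPolynomial.derivation_ext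
    intro i
    classical
    simp only [Derivation.commutator_apply, edgeDeriv, MvPolynomial.pderiv_X, Pi.single_apply]
    split_ifs <;> simp
  have h := DFunLike.congr_fun this f
  rw [Derivation.commutator_apply] at h
  exact sub_eq_zero.mp h

/-- An abstract expectation for the signal and noise variables: positive, normalised, with Gaussian
integration by parts in the off-diagonal noise variables, and with independent signal variables of
moments `mom`. -/
structure IsNoiseExpectation (mom : ℕ → ℝ) (E : NoisePoly →ₗ[ℝ] ℝ) : Prop where
  nonneg : ∀ f, (∀ ω, 0 ≤ MvPolynomial.eval ω f) → 0 ≤ E f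
  one : E 1 = 1
  ibp : ∀ e : Sym2 ℕ, ¬ e.IsDiag → ∀ f, E (noiVar e * f) = E (edgeDeriv e f)
  indep : ∀ i j, i ≠ j → ∀ k l, E (sigVar i ^ k * sigVar j ^ l) = mom k * mom l

namespace IsNoiseExpectation

variable {mom : ℕ → ℝ} {E : NoisePoly →ₗ[ℝ] ℝ}

lemma mono (hE : IsNoiseExpectation mom E) {f g : NoisePoly}
    (h : ∀ ω, MvPolynomial.eval ω f ≤ MvPolynomial.eval ω g) : E f ≤ E g := by
  have := hE.nonneg (g - f) (fun ω => by simpa using h ω)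
  simpa using this

lemma even_nonneg (hE : IsNoiseExpectation mom E) (f : NoisePoly) (p : ℕ) :
    0 ≤ E (f ^ (2 * p)) :=
  hE.nonneg _ fun ω => by rw [map_pow, pow_mul]; positivity

end IsNoiseExpectation

/-! ### Uniform boundedness of all moments. -/

/-- A set of polynomials is bounded if all even moments are bounded uniformly on it. -/
def MomentBdd (E : NoisePoly →ₗ[ℝ] ℝ) (S : Set NoisePoly) : Prop :=
  ∀ p : ℕ, ∃ C : ℝ, ∀ f ∈ S, E (f ^ (2 * p)) ≤ C

namespace MomentBdd

variable {mom : ℕ → ℝ} {E : NoisePoly →ₗ[ℝ] ℝ} {S T : Set NoisePoly}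

lemma mono (hT : MomentBdd E T) (h : S ⊆ T) : MomentBdd E S := fun p =>
  let ⟨C, hC⟩ := hT p
  ⟨C, fun f hf => hC f (h hf)⟩

lemma exists_pos (hS : MomentBdd E S) (p : ℕ) : ∃ C : ℝ, 0 < C ∧ ∀ f ∈ S, E (f ^ (2 * p)) ≤ C :=
  let ⟨C, hC⟩ := hS p
  ⟨max C 1, by positivity, fun f hf => (hC f hf).trans (le_max_left _ _)⟩

lemma singleton (f : NoisePoly) : MomentBdd E {f} := fun p =>
  ⟨E (f ^ (2 * p)), fun g hg => by rw [Set.mem_singleton_iff.1 hg]⟩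

lemma union (hS : MomentBdd E S) (hT : MomentBdd E T) : MomentBdd E (S ∪ T) := fun p => by
  obtain ⟨C, hC⟩ := hS p
  obtain ⟨D, hD⟩ := hT p
  exact ⟨max C D, fun f hf => hf.elim (fun h => (hC f h).trans (le_max_left _ _))
    fun h => (hD f h).trans (le_max_right _ _)⟩

/-- From `xy ≤ (x² + y²)/2` applied to powers; the moments needed of the factors have twice the
order, which is why boundedness is asked in all orders at once. -/
lemma mul (hE : IsNoiseExpectation mom E) (hS : MomentBdd E S) (hT : MomentBdd E T) :
    MomentBdd E (S * T) := fun p => by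
  obtain ⟨C, hC⟩ := hS (2 * p)
  obtain ⟨D, hD⟩ := hT (2 * p)
  refine ⟨(C + D) / 2, ?_⟩
  rintro _ ⟨f, hf, g, hg, rfl⟩
  have h1 : E ((f * g) ^ (2 * p)) ≤
      E ((1 / 2 : ℝ) • (f ^ (2 * (2 * p)) + g ^ (2 * (2 * p)))) := by
    refine hE.mono fun ω => ?_
    simp only [map_pow, map_mul, map_add, MvPolynomial.smul_eval]
    set x := MvPolynomial.eval ω f
    set y := MvPolynomial.eval ω g
    have hx : x ^ (2 * (2 * p)) = (x ^ (2 * p)) ^ 2 := by rw [← pow_mul]; ring_nf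
    have hy : y ^ (2 * (2 * p)) = (y ^ (2 * p)) ^ 2 := by rw [← pow_mul]; ring_nf
    rw [mul_pow, hx, hy]
    nlinarith [sq_nonneg (x ^ (2 * p) - y ^ (2 * p))]
  rw [map_smul, map_add, smul_eq_mul] at h1
  linarith [hC f hf, hD g hg]

lemma smul (hE : IsNoiseExpectation mom E) (hS : MomentBdd E S) (R : ℝ) :
    MomentBdd E {x | ∃ c : ℝ, ∃ f ∈ S, |c| ≤ R ∧ x = c • f} := fun p => by
  obtain ⟨C, hC0, hC⟩ := hS.exists_pos p
  refine ⟨R ^ (2 * p) * C, ?_⟩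
  rintro _ ⟨c, f, hf, hc, rfl⟩
  rw [smul_pow, map_smul, smul_eq_mul]
  have h1 : c ^ (2 * p) ≤ R ^ (2 * p) := by
    rw [← (even_two_mul p).pow_abs c]
    exact pow_le_pow_left₀ (abs_nonneg c) hc _
  have h2 := hE.even_nonneg f p
  have h3 : 0 ≤ c ^ (2 * p) := (even_two_mul p).pow_nonneg c
  exact mul_le_mul h1 (hC f hf) h2 (h3.trans h1)

/-- By the power mean inequality the constant depends neither on the number of terms nor on `n`. -/
lemma avg (hE : IsNoiseExpectation mom E) (hS : MomentBdd E S) :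
    MomentBdd E {x | ∃ (κ : Type) (s : Finset κ) (g : κ → NoisePoly) (n : ℕ), s.card ≤ n ∧
      (∀ k ∈ s, g k ∈ S) ∧ x = (n : ℝ)⁻¹ • ∑ k ∈ s, g k} := fun p => by
  obtain ⟨C, hC0, hC⟩ := hS.exists_pos p
  -- The value `1` covers `p = 0`, where every power is `1`.
  refine ⟨max C 1, ?_⟩
  rintro _ ⟨κ, s, g, n, hn, hg, rfl⟩
  rcases Nat.eq_zero_or_pos p with rfl | hp
  · simp [hE.one]
  rcases Nat.eq_zero_or_pos n with rfl | hn0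
  · simp only [Nat.cast_zero, inv_zero, zero_smul, zero_pow (show 2 * p ≠ 0 by omega), map_zero]
    positivity
  obtain ⟨q, hq⟩ : ∃ q, 2 * p = q + 1 := ⟨2 * p - 1, by omega⟩
  refine le_trans ?_ (le_max_left _ _)
  have h1 : E ((∑ k ∈ s, g k) ^ (2 * p)) ≤ E (((s.card : ℝ) ^ q) • ∑ k ∈ s, g k ^ (2 * p)) := by
    refine hE.mono fun ω => ?_
    simp only [map_pow, map_sum, MvPolynomial.smul_eval]
    calc (∑ k ∈ s, MvPolynomial.eval ω (g k)) ^ (2 * p)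
        = |∑ k ∈ s, MvPolynomial.eval ω (g k)| ^ (2 * p) := ((even_two_mul p).pow_abs _).symm
      _ ≤ (∑ k ∈ s, |MvPolynomial.eval ω (g k)|) ^ (2 * p) :=
          pow_le_pow_left₀ (abs_nonneg _) (Finset.abs_sum_le_sum_abs _ _) _
      _ ≤ s.card ^ q * ∑ k ∈ s, |MvPolynomial.eval ω (g k)| ^ (2 * p) := by
          rw [hq]
          exact pow_sum_le_card_mul_sum_pow (fun i _ => abs_nonneg _) q
      _ = _ := by simp only [(even_two_mul p).pow_abs]
  rw [map_smul, map_sum, smul_eq_mul] at h1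
  rw [smul_pow, map_smul, smul_eq_mul]
  have h2 : ∑ k ∈ s, E (g k ^ (2 * p)) ≤ s.card * C := by
    rw [← nsmul_eq_mul]
    exact Finset.sum_le_card_nsmul _ _ _ fun k hk => hC _ (hg k hk)
  have hcn : (s.card : ℝ) ≤ n := by exact_mod_cast hn
  have hn' : (0 : ℝ) < n := by exact_mod_cast hn0
  calc ((n : ℝ)⁻¹) ^ (2 * p) * E ((∑ k ∈ s, g k) ^ (2 * p))
      ≤ ((n : ℝ)⁻¹) ^ (2 * p) * ((s.card : ℝ) ^ q * (s.card * C)) := by gcongr; exact h1.trans (by gcongr)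
    _ = ((n : ℝ)⁻¹ * s.card) ^ (2 * p) * C := by rw [mul_pow, hq]; ring
    _ ≤ 1 * C := by
        gcongr
        refine pow_le_one₀ (by positivity) ?_
        rw [inv_mul_le_iff₀ hn']; simpa using hcn
    _ = C := one_mul C

lemma sum (hE : IsNoiseExpectation mom E) (hS : MomentBdd E S) (R : ℕ) :
    MomentBdd E {x | ∃ (κ : Type) (s : Finset κ) (g : κ → NoisePoly), s.card ≤ R ∧
      (∀ k ∈ s, g k ∈ S) ∧ x = ∑ k ∈ s, g k} := by
  refine ((hS.avg hE).smul hE (R + 1)).mono ?_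
  rintro _ ⟨κ, s, g, hs, hg, rfl⟩
  -- The sum is `R + 1` times an average; the shift avoids dividing by zero when `R = 0`.
  refine ⟨R + 1, _, ⟨κ, s, g, R + 1, by omega, hg, rfl⟩, ?_, ?_⟩
  · rw [abs_of_nonneg (by positivity)]
  · rw [smul_smul]; push_cast; rw [mul_inv_cancel₀ (by positivity), one_smul]

lemma add (hE : IsNoiseExpectation mom E) (hS : MomentBdd E S) (hT : MomentBdd E T) :
    MomentBdd E (S + T) := by
  refine ((hS.union hT).sum hE 2).mono ?_
  rintro _ ⟨f, hf, g, hg, rfl⟩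
  refine ⟨Bool, Finset.univ, fun b => if b then f else g, by simp, ?_, by simp⟩
  rintro (_ | _) _ <;> simp [hf, hg]

lemma abs_expect_le (hE : IsNoiseExpectation mom E) (hS : MomentBdd E S) :
    ∃ C : ℝ, 0 < C ∧ ∀ f ∈ S, |E f| ≤ C := by
  obtain ⟨C, hC0, hC⟩ := hS.exists_pos 1
  refine ⟨(C + 1) / 2, by positivity, fun f hf => _root_.abs_le.2 ?_⟩
  have h1 := hE.mono (f := f) (g := (1 / 2 : ℝ) • (f ^ (2 * 1) + 1)) fun ω => by
    simp only [map_pow, map_add, MvPolynomial.smul_eval, map_one]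
    nlinarith [sq_nonneg (MvPolynomial.eval ω f - 1)]
  have h2 := hE.mono (f := -f) (g := (1 / 2 : ℝ) • (f ^ (2 * 1) + 1)) fun ω => by
    simp only [map_pow, map_add, MvPolynomial.smul_eval, map_one, map_neg]
    nlinarith [sq_nonneg (MvPolynomial.eval ω f + 1)]
  simp only [map_smul, map_add, smul_eq_mul, hE.one, map_neg] at h1 h2
  have := hC f hf
  constructor <;> linarith

end MomentBdd

lemma IsNoiseExpectation.momentBdd_sigVar {mom : ℕ → ℝ} {E : NoisePoly →ₗ[ℝ] ℝ}
    (hE : IsNoiseExpectation mom E) : MomentBdd E (Set.range sigVar) := fun p => by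
  refine ⟨mom (2 * p) * mom 0, ?_⟩
  rintro _ ⟨i, rfl⟩
  -- A second signal with exponent `0` turns the pair axiom into a statement about one signal.
  have := hE.indep i (i + 1) (by omega) (2 * p) 0
  simpa using this.le

/-- Integration by parts gives the Gaussian recursion `E X^{2p+2} = (2p+1) E X^{2p}`. -/
lemma IsNoiseExpectation.momentBdd_noiVar {mom : ℕ → ℝ} {E : NoisePoly →ₗ[ℝ] ℝ}
    (hE : IsNoiseExpectation mom E) :
    MomentBdd E {x | ∃ e : Sym2 ℕ, ¬ e.IsDiag ∧ x = noiVar e} := fun p => by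
  induction p with
  | zero => exact ⟨1, fun f _ => by simp [hE.one]⟩
  | succ p ih =>
    obtain ⟨C, hC⟩ := ih
    refine ⟨(2 * p + 1) * C, ?_⟩
    rintro _ ⟨e, he, rfl⟩
    have h1 : noiVar e ^ (2 * (p + 1)) = noiVar e * noiVar e ^ (2 * p + 1) := by ring
    rw [h1, hE.ibp e he, Derivation.leibniz_pow, edgeDeriv_noiVar_self]
    simp only [smul_eq_mul, mul_one, map_nsmul, Nat.add_sub_cancel]
    rw [nsmul_eq_mul]; push_cast
    exact mul_le_mul_of_nonneg_left (hC _ ⟨e, he, rfl⟩) (by positivity)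

/-! ### Iterated derivatives and Leibniz rules. -/

/-- Iterated derivative along a list of edges. -/
def iterD : List (Sym2 ℕ) → NoisePoly →ₗ[ℝ] NoisePoly
  | [] => LinearMap.id
  | e :: L => (edgeDeriv e).toLinearMap ∘ₗ iterD L

@[simp] lemma iterD_nil (f : NoisePoly) : iterD [] f = f := rfl

@[simp] lemma iterD_cons (e : Sym2 ℕ) (L : List (Sym2 ℕ)) (f : NoisePoly) :
    iterD (e :: L) f = edgeDeriv e (iterD L f) := rfl

lemma iterD_append (L L' : List (Sym2 ℕ)) (f : NoisePoly) :
    iterD (L ++ L') f = iterD L (iterD L' f) := by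
  induction L with
  | nil => rfl
  | cons e L ih => simp [ih]

lemma iterD_perm {L L' : List (Sym2 ℕ)} (h : L.Perm L') (f : NoisePoly) :
    iterD L f = iterD L' f := by
  induction h with
  | nil => rfl
  | cons e _ ih => simp [ih]
  | swap e e' L => simp [edgeDeriv_comm e e']
  | trans _ _ h1 h2 => exact h1.trans h2

/-- In the Leibniz expansion at most one derivative can fall on the degree-one factor, and there is
one choice for each occurrence of its edge in the list. -/
lemma iterD_noiVar_mul (e : Sym2 ℕ) (L : List (Sym2 ℕ)) (f : NoisePoly) :
    iterD L (noiVar e * f) = noiVar e * iterD L f + (L.count e : ℝ) • iterD (L.erase e) f := by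
  induction L with
  | nil => simp
  | cons e' L ih =>
    rw [iterD_cons, ih, map_add, edgeDeriv_mul, Derivation.map_smul]
    by_cases h : e' = e
    · subst h
      rw [edgeDeriv_noiVar_self, List.erase_cons_head, List.count_cons_self]
      by_cases hm : e' ∈ L
      · rw [← iterD_cons e' (L.erase e'), ← iterD_perm (List.perm_cons_erase hm)]
        push_cast
        rw [add_smul, one_mul, one_smul, iterD_cons]
        abel
      · rw [List.count_eq_zero_of_not_mem hm]
        simp [add_comm]
    · have h1 : (e' :: L).erase e = e' :: L.erase e := List.erase_cons_tail (by simpa using h)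
      rw [edgeDeriv_noiVar_of_ne (Ne.symm h), h1, List.count_cons_of_ne h]
      simp

lemma iterD_sigVar_mul (i : ℕ) (L : List (Sym2 ℕ)) (f : NoisePoly) :
    iterD L (sigVar i * f) = sigVar i * iterD L f := by
  induction L with
  | nil => simp
  | cons e L ih => simp [ih, edgeDeriv_sigVar]

/-- All ways of distributing a list over two lists. -/
def listSplits {α : Type} : List α → List (List α × List α)
  | [] => [([], [])]
  | e :: L => (listSplits L).map (fun s => (e :: s.1, s.2)) ++
      (listSplits L).map (fun s => (s.1, e :: s.2))

lemma length_listSplits {α : Type} (L : List α) : (listSplits L).length = 2 ^ L.length := by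
  induction L with
  | nil => rfl
  | cons e L ih => simp [listSplits, ih]; ring

lemma length_of_mem_listSplits {α : Type} {L : List α} {s : List α × List α}
    (h : s ∈ listSplits L) : s.1.length + s.2.length = L.length := by
  induction L generalizing s with
  | nil => simp [listSplits] at h; simp [h]
  | cons e L ih =>
    simp only [listSplits, List.mem_append, List.mem_map] at h
    rcases h with ⟨u, hu, rfl⟩ | ⟨u, hu, rfl⟩ <;> · have := ih hu; simp; omega

lemma mem_of_mem_listSplits {α : Type} {L : List α} {s : List α × List α}
    (h : s ∈ listSplits L) (x : α) : x ∈ L ↔ x ∈ s.1 ∨ x ∈ s.2 := by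
  induction L generalizing s with
  | nil => simp [listSplits] at h; simp [h]
  | cons e L ih =>
    simp only [listSplits, List.mem_append, List.mem_map] at h
    rcases h with ⟨u, hu, rfl⟩ | ⟨u, hu, rfl⟩ <;> · have := ih hu; simp [this]; tauto

lemma iterD_mul (L : List (Sym2 ℕ)) (f g : NoisePoly) :
    iterD L (f * g) = ((listSplits L).map fun s => iterD s.1 f * iterD s.2 g).sum := by
  induction L with
  | nil => simp [listSplits]
  | cons e L ih =>
    rw [iterD_cons, ih, map_list_sum, listSplits, List.map_append, List.sum_append, List.map_map,
      List.map_map, List.map_map, ← List.sum_map_add]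
    congr 1
    refine List.map_congr_left fun s _ => ?_
    simp only [Function.comp_apply, edgeDeriv_mul, iterD_cons]
end

noncomputable section

open scoped Pointwise

/-! ### Moment bounds for Gaussian divergences -/

/-- The data of a sum of noise variables over the edges from a centre to a set of vertices,
normalised by a size. -/
structure SumCtx where
  size : ℕ
  center : ℕ
  verts : Finset ℕ
  card_le : verts.card ≤ size
  center_notMem : center ∉ verts

/-- The family of scaled derivatives `√n ∂_{ac} f`, over the edges of the context. -/
def scaledDeriv {ι : Type} (γ : ι → SumCtx) (f : ι → NoisePoly) :
    (Σ i, (γ i).verts) → NoisePoly :=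
  fun x => √((γ x.1).size : ℝ) • edgeDeriv s((γ x.1).center, (x.2 : ℕ)) (f x.1)

/-- The divergence `n^{-1/2} ∑_c X_{ac} y_c`. -/
def noiseSum {ι : Type} (γ : ι → SumCtx) (y : (Σ i, (γ i).verts) → NoisePoly) (i : ι) :
    NoisePoly :=
  (√((γ i).size : ℝ))⁻¹ • ∑ c : (γ i).verts, noiVar s((γ i).center, (c : ℕ)) * y ⟨i, c⟩

/-- The scaled derivatives of a family up to order `r` are bounded. -/
def SmoothBdd (E : NoisePoly →ₗ[ℝ] ℝ) :
    ℕ → ∀ {ι : Type}, (ι → SumCtx) → (ι → NoisePoly) → Prop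
  | 0, _, _, f => MomentBdd E (Set.range f)
  | r + 1, _, γ, f => MomentBdd E (Set.range f) ∧
      SmoothBdd E r (fun x : Σ i, (γ i).verts => γ x.1) (scaledDeriv γ f)

namespace SmoothBdd

variable {mom : ℕ → ℝ} {E : NoisePoly →ₗ[ℝ] ℝ} {r : ℕ}

lemma momentBdd {ι : Type} {γ : ι → SumCtx} {f : ι → NoisePoly} (h : SmoothBdd E r γ f) :
    MomentBdd E (Set.range f) := by
  cases r with
  | zero => exact h
  | succ r => exact h.1

/-- Each derivative enlarges the index type by a vertex. Reindexing lets a factor ignore, duplicate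
or exchange such vertices. -/
lemma comp {ι κ : Type} {γ : ι → SumCtx} {f : ι → NoisePoly} (h : SmoothBdd E r γ f)
    (g : κ → ι) : SmoothBdd E r (fun k => γ (g k)) (fun k => f (g k)) := by
  induction r generalizing ι κ with
  | zero => exact h.mono (Set.range_comp_subset_range g f)
  | succ r ih =>
    refine ⟨h.1.mono (Set.range_comp_subset_range g f), ?_⟩
    exact ih h.2 (fun x : Σ k, (γ (g k)).verts => (⟨g x.1, x.2⟩ : Σ i, (γ i).verts))

lemma add (hE : IsNoiseExpectation mom E) {ι : Type} {γ : ι → SumCtx} {f g : ι → NoisePoly}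
    (hf : SmoothBdd E r γ f) (hg : SmoothBdd E r γ g) :
    SmoothBdd E r γ (fun i => f i + g i) := by
  have key : ∀ {ι : Type} {f g : ι → NoisePoly}, MomentBdd E (Set.range f) →
      MomentBdd E (Set.range g) → MomentBdd E (Set.range fun i => f i + g i) := by
    intro ι f g hf hg
    refine (hf.add hE hg).mono ?_
    rintro _ ⟨i, rfl⟩
    exact Set.add_mem_add ⟨i, rfl⟩ ⟨i, rfl⟩
  induction r generalizing ι with
  | zero => exact key hf hg
  | succ r ih =>
    refine ⟨key hf.1 hg.1, ?_⟩
    have := ih hf.2 hg.2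
    convert this using 2 with x
    simp [scaledDeriv]

lemma of_succ {ι : Type} {γ : ι → SumCtx} {f : ι → NoisePoly} (h : SmoothBdd E (r + 1) γ f) :
    SmoothBdd E r γ f := by
  induction r generalizing ι with
  | zero => exact h.1
  | succ r ih => exact ⟨h.1, ih h.2⟩

lemma mul (hE : IsNoiseExpectation mom E) {ι : Type} {γ : ι → SumCtx} {f g : ι → NoisePoly}
    (hf : SmoothBdd E r γ f) (hg : SmoothBdd E r γ g) :
    SmoothBdd E r γ (fun i => f i * g i) := by
  have key : ∀ {ι : Type} {f g : ι → NoisePoly}, MomentBdd E (Set.range f) →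
      MomentBdd E (Set.range g) → MomentBdd E (Set.range fun i => f i * g i) := by
    intro ι f g hf hg
    refine (hf.mul hE hg).mono ?_
    rintro _ ⟨i, rfl⟩
    exact Set.mul_mem_mul ⟨i, rfl⟩ ⟨i, rfl⟩
  induction r generalizing ι with
  | zero => exact key hf hg
  | succ r ih =>
    refine ⟨key hf.1 hg.1, ?_⟩
    have h1 := ih hf.2 (hg.of_succ.comp fun x : Σ i, (γ i).verts => x.1)
    have h2 := ih (hf.of_succ.comp fun x : Σ i, (γ i).verts => x.1) hg.2
    convert h1.add hE h2 using 2 with x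
    simp only [scaledDeriv, edgeDeriv_mul, smul_add, smul_mul_assoc, mul_smul_comm]

/-- A criterion by iterated derivatives. -/
lemma of_iterD {ι : Type} {γ : ι → SumCtx} {f : ι → NoisePoly}
    (h : ∀ k ≤ r, MomentBdd E {x | ∃ i, ∃ L : List ℕ, L.length = k ∧ (∀ c ∈ L, c ∈ (γ i).verts) ∧
      x = √((γ i).size : ℝ) ^ k • iterD (L.map fun c => s((γ i).center, c)) (f i)}) :
    SmoothBdd E r γ f := by
  have h0 : MomentBdd E (Set.range f) := by
    refine (h 0 (Nat.zero_le r)).mono ?_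
    rintro _ ⟨i, rfl⟩
    exact ⟨i, [], rfl, by simp, by simp⟩
  induction r generalizing ι with
  | zero => exact h0
  | succ r ih =>
    have h1 : ∀ k ≤ r, MomentBdd E {x | ∃ i : Σ i, (γ i).verts, ∃ L : List ℕ, L.length = k ∧
        (∀ c ∈ L, c ∈ (γ i.1).verts) ∧
        x = √((γ i.1).size : ℝ) ^ k •
          iterD (L.map fun c => s((γ i.1).center, c)) (scaledDeriv γ f i)} := by
      intro k hk
      refine (h (k + 1) (by omega)).mono ?_
      rintro _ ⟨⟨i, c⟩, L, hL, hLs, rfl⟩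
      -- The derivative already contained in `scaledDeriv` acts first, so its vertex goes to the end
      -- of the list.
      refine ⟨i, L ++ [(c : ℕ)], by simp [hL], ?_, ?_⟩
      · simp only [List.mem_append, List.mem_singleton]
        rintro c' (hc' | rfl)
        exacts [hLs c' hc', c.2]
      · simp only [scaledDeriv, map_smul, smul_smul, pow_succ, List.map_append, List.map_cons,
          List.map_nil, iterD_append, iterD_cons, iterD_nil]
    refine ⟨h0, ih h1 ?_⟩
    refine (h1 0 (Nat.zero_le r)).mono ?_
    rintro _ ⟨i, rfl⟩
    exact ⟨i, [], rfl, by simp, by simp⟩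

end SmoothBdd

/-- Families built from smooth bounded families with at most `q` divergence factors. -/
inductive DivClass (E : NoisePoly →ₗ[ℝ] ℝ) {ι : Type} (γ : ι → SumCtx) :
    ℕ → (ι → NoisePoly) → Prop
  | smooth {q : ℕ} {f : ι → NoisePoly} : (∀ r, SmoothBdd E r γ f) → DivClass E γ q f
  | add {q : ℕ} {f g : ι → NoisePoly} :
      DivClass E γ q f → DivClass E γ q g → DivClass E γ q (fun i => f i + g i)
  | mul {q : ℕ} {y : (Σ i, (γ i).verts) → NoisePoly} {f : ι → NoisePoly} :
      (∀ r, SmoothBdd E r (fun x : Σ i, (γ i).verts => γ x.1) y) → DivClass E γ q f →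
      DivClass E γ (q + 1) (fun i => noiseSum γ y i * f i)

namespace DivClass

variable {mom : ℕ → ℝ} {E : NoisePoly →ₗ[ℝ] ℝ} {q : ℕ}

lemma comp {ι κ : Type} {γ : ι → SumCtx} {f : ι → NoisePoly} (h : DivClass E γ q f)
    (g : κ → ι) : DivClass E (fun k => γ (g k)) q (fun k => f (g k)) := by
  induction h with
  | smooth h => exact .smooth fun r => (h r).comp g
  | add _ _ ih1 ih2 => exact .add ih1 ih2
  | @mul q y f hy _ ih =>
    exact DivClass.mul (γ := fun k => γ (g k)) (y := fun x => y ⟨g x.1, x.2⟩)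
      (fun r => (hy r).comp (fun x : Σ k, (γ (g k)).verts => (⟨g x.1, x.2⟩ : Σ i, (γ i).verts))) ih

lemma succ {ι : Type} {γ : ι → SumCtx} {f : ι → NoisePoly} (h : DivClass E γ q f) :
    DivClass E γ (q + 1) f := by
  induction h with
  | smooth h => exact .smooth h
  | add _ _ ih1 ih2 => exact .add ih1 ih2
  | mul hy _ ih => exact .mul hy ih

lemma smooth_mul (hE : IsNoiseExpectation mom E) {ι : Type} {γ : ι → SumCtx}
    {f g : ι → NoisePoly} (hg : ∀ r, SmoothBdd E r γ g) (h : DivClass E γ q f) :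
    DivClass E γ q (fun i => g i * f i) := by
  induction h with
  | smooth h => exact .smooth fun r => (hg r).mul hE (h r)
  | add _ _ ih1 ih2 => simpa only [mul_add] using DivClass.add ih1 ih2
  | mul hy _ ih => simpa only [mul_left_comm] using DivClass.mul hy ih

/-- The commutation relation `D_c δ(y) = y_c + δ(D_c y)` between derivative and divergence. Distinct
vertices give distinct edges because the centre is not among the vertices. -/
lemma scaledDeriv_noiseSum {ι : Type} (γ : ι → SumCtx) (y : (Σ i, (γ i).verts) → NoisePoly)
    (x : Σ i, (γ i).verts) (hx : 0 < (γ x.1).size) :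
    scaledDeriv γ (noiseSum γ y) x = y x +
      noiseSum (fun x : Σ i, (γ i).verts => γ x.1)
        (fun z => scaledDeriv (fun x : Σ i, (γ i).verts => γ x.1) y ⟨⟨z.1.1, z.2⟩, z.1.2⟩) x := by
  obtain ⟨i, c⟩ := x
  have hs : √((γ i).size : ℝ) ≠ 0 := by
    have : (0 : ℝ) < (γ i).size := by exact_mod_cast hx
    positivity
  simp only [scaledDeriv, noiseSum, Derivation.map_smul, map_sum, edgeDeriv_mul, smul_smul,
    mul_inv_cancel₀ hs, one_smul, Finset.sum_add_distrib, mul_smul_comm, ← Finset.smul_sum,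
    inv_mul_cancel₀ hs]
  congr 1
  rw [Finset.sum_eq_single c]
  · rw [edgeDeriv_noiVar_self, one_mul]
  · intro c' _ hc'
    rw [edgeDeriv_noiVar_of_ne, zero_mul]
    intro h
    rcases Sym2.eq_iff.1 h with ⟨-, h⟩ | ⟨h, -⟩
    · exact hc' (Subtype.ext h)
    · exact (γ i).center_notMem (h ▸ c.2)
  · simp

/-- By the commutation relation, differentiating `δ(y) f` gives `δ(y) Df + y f + δ(Dy) f`, so a
scaled derivative never increases the number of divergence factors. -/
lemma scaledDeriv (hE : IsNoiseExpectation mom E) {ι : Type} {γ : ι → SumCtx}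
    {f : ι → NoisePoly} (h : DivClass E γ q f) :
    DivClass E (fun x : Σ i, (γ i).verts => γ x.1) q (scaledDeriv γ f) := by
  induction h with
  | smooth h => exact .smooth fun r => (h (r + 1)).2
  | add _ _ ih1 ih2 =>
    convert DivClass.add ih1 ih2 using 2 with x
    simp [_root_.scaledDeriv]
  | @mul q y f hy hf ih =>
    have h1 : DivClass E (fun x : Σ i, (γ i).verts => γ x.1) (q + 1)
        (fun x => noiseSum (fun x : Σ i, (γ i).verts => γ x.1)
          (fun z => y ⟨z.1.1, z.2⟩) x * _root_.scaledDeriv γ f x) :=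
      .mul (fun r => (hy r).comp
        (fun z : (Σ x : (Σ i, (γ i).verts), (γ x.1).verts) =>
          (⟨z.1.1, z.2⟩ : Σ i, (γ i).verts))) ih
    have h2 : DivClass E (fun x : Σ i, (γ i).verts => γ x.1) (q + 1)
        (fun x => y x * f x.1) :=
      (smooth_mul hE hy (hf.comp fun x : Σ i, (γ i).verts => x.1)).succ
    have h3 : DivClass E (fun x : Σ i, (γ i).verts => γ x.1) (q + 1)
        (fun x => noiseSum (fun x : Σ i, (γ i).verts => γ x.1)
          (fun z => _root_.scaledDeriv (fun x : Σ i, (γ i).verts => γ x.1) y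
            ⟨⟨z.1.1, z.2⟩, z.1.2⟩) x * f x.1) :=
      .mul (fun r => ((hy (r + 1)).2.comp
        (fun z : (Σ x : (Σ i, (γ i).verts), (γ x.1).verts) =>
          (⟨⟨z.1.1, z.2⟩, z.1.2⟩ : (Σ x : (Σ i, (γ i).verts), (γ x.1).verts)))))
        (hf.comp fun x : Σ i, (γ i).verts => x.1)
    convert (h1.add h2).add h3 using 2 with x
    have hx : 0 < (γ x.1).size :=
      (Finset.card_pos.2 ⟨(x.2 : ℕ), x.2.2⟩).trans_le (γ x.1).card_le
    have h4 := scaledDeriv_noiseSum γ y x hx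
    have h5 : _root_.scaledDeriv γ (fun i => noiseSum γ y i * f i) x =
        noiseSum γ y x.1 * _root_.scaledDeriv γ f x +
          _root_.scaledDeriv γ (noiseSum γ y) x * f x.1 := by
      simp only [_root_.scaledDeriv, edgeDeriv_mul, smul_add, mul_smul_comm, smul_mul_assoc]
      ring
    rw [h5, h4]
    simp only [noiseSum]
    ring

/-- Induction on the number of divergences. Integration by parts gives `E[δ(y) f] = n⁻¹ ∑_c
E[D_c(y_c f)]`, an average of at most `n` expectations in the class with one divergence fewer. -/
lemma abs_expect_le (hE : IsNoiseExpectation mom E) {ι : Type} {γ : ι → SumCtx}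
    {f : ι → NoisePoly} (h : DivClass E γ q f) : ∃ C : ℝ, ∀ i, |E (f i)| ≤ C := by
  induction q generalizing ι with
  | zero =>
    generalize hq : 0 = q at h
    induction h with
    | smooth h =>
      obtain ⟨C, -, hC⟩ := (h 0).momentBdd.abs_expect_le hE
      exact ⟨C, fun i => hC _ ⟨i, rfl⟩⟩
    | add _ _ ih1 ih2 =>
      obtain ⟨C, hC⟩ := ih1 hq
      obtain ⟨D, hD⟩ := ih2 hq
      exact ⟨C + D, fun i => by
        rw [map_add]; exact (abs_add_le _ _).trans (add_le_add (hC i) (hD i))⟩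
    | mul _ _ _ => omega
  | succ q IH =>
    generalize hq : q + 1 = q' at h
    induction h with
    | smooth h =>
      obtain ⟨C, -, hC⟩ := (h 0).momentBdd.abs_expect_le hE
      exact ⟨C, fun i => hC _ ⟨i, rfl⟩⟩
    | add _ _ ih1 ih2 =>
      obtain ⟨C, hC⟩ := ih1 hq
      obtain ⟨D, hD⟩ := ih2 hq
      exact ⟨C + D, fun i => by
        rw [map_add]; exact (abs_add_le _ _).trans (add_le_add (hC i) (hD i))⟩
    | @mul q' y f hy hf _ =>
      obtain rfl : q = q' := by omega
      obtain ⟨C, hC⟩ := IH (DivClass.scaledDeriv hE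
        (smooth_mul hE hy (hf.comp fun x : Σ i, (γ i).verts => x.1)))
      refine ⟨max C 0, fun i => ?_⟩
      rcases Nat.eq_zero_or_pos (γ i).size with h0 | hpos
      · simp [noiseSum, h0]
      have hs : (0 : ℝ) < (γ i).size := by exact_mod_cast hpos
      have hs' : 0 < √((γ i).size : ℝ) := by positivity
      have h1 : E (noiseSum γ y i * f i) = ((γ i).size : ℝ)⁻¹ * ∑ c : (γ i).verts,
          E (_root_.scaledDeriv (fun x : Σ i, (γ i).verts => γ x.1)
            (fun x => y x * f x.1) ⟨⟨i, c⟩, c⟩) := by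
        simp only [noiseSum, smul_mul_assoc, map_smul, Finset.sum_mul, map_sum, smul_eq_mul,
          Finset.mul_sum]
        refine Finset.sum_congr rfl fun c _ => ?_
        rw [mul_assoc, hE.ibp]
        · simp only [_root_.scaledDeriv, map_smul, smul_eq_mul]
          rw [← mul_assoc]
          congr 1
          nth_rw 2 [← Real.mul_self_sqrt hs.le]
          field_simp
        · rw [Sym2.mk_isDiag_iff]
          intro h
          exact (γ i).center_notMem (h ▸ c.2)
      rw [h1, abs_mul, abs_of_nonneg (by positivity), inv_mul_le_iff₀ hs]
      refine (Finset.abs_sum_le_sum_abs _ _).trans ?_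
      refine (Finset.sum_le_card_nsmul _ _ (max C 0) fun c _ =>
        (hC _).trans (le_max_left _ _)).trans ?_
      rw [nsmul_eq_mul]
      refine mul_le_mul_of_nonneg_right ?_ (le_max_right _ _)
      have := (γ i).card_le
      simpa using this

end DivClass

/-- A divergence of a smooth bounded family has bounded moments. -/
theorem SmoothBdd.momentBdd_noiseSum {mom : ℕ → ℝ} {E : NoisePoly →ₗ[ℝ] ℝ}
    (hE : IsNoiseExpectation mom E) {ι : Type} {γ : ι → SumCtx}
    {y : (Σ i, (γ i).verts) → NoisePoly}
    (hy : ∀ r, SmoothBdd E r (fun x : Σ i, (γ i).verts => γ x.1) y) :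
    MomentBdd E (Set.range (noiseSum γ y)) := fun p => by
  -- A power of a divergence is a product of divergences with the constant `1`, which is smooth;
  -- bounding moments thus reduces to bounding expectations in the class.
  have h : ∀ q, DivClass E γ (q + 1) (fun i => noiseSum γ y i ^ (q + 1)) := by
    intro q
    induction q with
    | zero =>
      have h1 : DivClass E γ 0 (fun _ : ι => (1 : NoisePoly)) := by
        refine .smooth fun r => SmoothBdd.of_iterD fun k _ => ?_
        refine (MomentBdd.singleton (0 : NoisePoly)).union (.singleton (1 : NoisePoly)) |>.mono ?_
        rintro _ ⟨i, L, hL, -, rfl⟩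
        cases L with
        | nil => right; simp [← hL]
        | cons c L =>
          left
          have : ∀ L : List (Sym2 ℕ), ∀ e, edgeDeriv e (iterD L (1 : NoisePoly)) = 0 := by
            intro L
            induction L with
            | nil => intro e; simp
            | cons e' L ih => intro e; simp [ih]
          simp [this]
      simpa using DivClass.mul hy h1
    | succ q ih => simpa only [pow_succ' _ (q + 1)] using DivClass.mul hy ih
  rcases Nat.eq_zero_or_pos p with rfl | hp
  · exact ⟨1, fun f _ => by simp [hE.one]⟩
  obtain ⟨C, hC⟩ := (h (2 * p - 1)).abs_expect_le hE
  refine ⟨C, ?_⟩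
  rintro _ ⟨i, rfl⟩
  have := (le_abs_self _).trans (hC i)
  rwa [show 2 * p - 1 + 1 = 2 * p by omega] at this
end

noncomputable section

open scoped Pointwise

/-! ### Derivative bounds for the messages -/

/-- The observation `Y_{ak}` as a polynomial. -/
def obsPoly (n a k : ℕ) : NoisePoly :=
  (√(n : ℝ))⁻¹ • (sigVar a * sigVar k) + noiVar s(a, k)

/-- One step of the message recursion. -/
def msgStep (f : ℕ → ℕ → ℕ → NoisePoly) (n a b : ℕ) : NoisePoly :=
  if a = b then 0
  else (√(n : ℝ))⁻¹ • ∑ k ∈ Finset.range n \ {a, b}, obsPoly n a k * f n k a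

/-- The messages as polynomials in the signal and noise variables. -/
def msgPoly {d : ℕ} (F : ℕ → Fin d → MvPolynomial (Fin d) ℝ) :
    ℕ → ℕ → ℕ → ℕ → Fin d → NoisePoly
  | 0, _, _, _ => 0
  | t + 1, n, a, b => fun α =>
      msgStep (fun n k a => MvPolynomial.aeval (msgPoly F t n k a) (F t α)) n a b

/-- The decay exponent of the derivative of a message `a → b` along a list of edges: an extra
factor appears if no edge of the list enters the message directly. -/
def edgeWeight (a b : ℕ) (L : List (Sym2 ℕ)) : ℕ :=
  L.length + if L ≠ [] ∧ ∀ e ∈ L, ¬ (a ∈ e ∧ e ≠ s(a, b)) then 1 else 0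

lemma length_le_edgeWeight (a b : ℕ) (L : List (Sym2 ℕ)) : L.length ≤ edgeWeight a b L :=
  Nat.le_add_right _ _

lemma edgeWeight_le (a b : ℕ) (L : List (Sym2 ℕ)) : edgeWeight a b L ≤ L.length + 1 := by
  unfold edgeWeight; split_ifs <;> omega

lemma edgeWeight_nil (a b : ℕ) : edgeWeight a b [] = 0 := by simp [edgeWeight]

lemma edgeWeight_of_forall {a b : ℕ} {L : List (Sym2 ℕ)} (h0 : L ≠ [])
    (h : ∀ e ∈ L, ¬ (a ∈ e ∧ e ≠ s(a, b))) : edgeWeight a b L = L.length + 1 := by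
  rw [edgeWeight, if_pos ⟨h0, h⟩]

lemma edgeWeight_of_mem {a b : ℕ} {L : List (Sym2 ℕ)} {e : Sym2 ℕ} (he : e ∈ L) (ha : a ∈ e)
    (hb : e ≠ s(a, b)) : edgeWeight a b L = L.length := by
  rw [edgeWeight, if_neg, add_zero]
  exact fun h => h.2 e he ⟨ha, hb⟩

/-- If no edge of `L` enters directly, the same holds for each part, and a nonempty part already
carries the extra unit. Hence the weighted bounds survive the Leibniz rule. -/
lemma edgeWeight_le_add_of_mem_listSplits (a b : ℕ) {L : List (Sym2 ℕ)}
    {s : List (Sym2 ℕ) × List (Sym2 ℕ)} (hs : s ∈ listSplits L) :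
    edgeWeight a b L ≤ edgeWeight a b s.1 + edgeWeight a b s.2 := by
  have hl := length_of_mem_listSplits hs
  have hm := mem_of_mem_listSplits hs
  have h1 := length_le_edgeWeight a b s.1
  have h2 := length_le_edgeWeight a b s.2
  by_cases h : L ≠ [] ∧ ∀ e ∈ L, ¬ (a ∈ e ∧ e ≠ s(a, b))
  · rw [edgeWeight_of_forall h.1 h.2]
    by_cases h3 : s.1 = []
    · have h4 : s.2 ≠ [] := by
        intro h4
        rw [h3, h4] at hl
        exact h.1 (List.length_eq_zero_iff.1 hl.symm)
      rw [edgeWeight_of_forall h4 fun e he => h.2 e ((hm e).2 (Or.inr he))]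
      omega
    · rw [edgeWeight_of_forall h3 fun e he => h.2 e ((hm e).2 (Or.inl he))]
      omega
  · rw [edgeWeight, if_neg h]
    omega

/-- All derivatives of the family are bounded after scaling by the decay exponent. -/
def WeightBdd (E : NoisePoly →ₗ[ℝ] ℝ) (f : ℕ → ℕ → ℕ → NoisePoly) : Prop :=
  ∀ r, MomentBdd E {x | ∃ (n a b : ℕ) (L : List (Sym2 ℕ)) (c : ℝ), 1 ≤ n ∧ L.length ≤ r ∧
    |c| ≤ √(n : ℝ) ^ edgeWeight a b L ∧ x = c • iterD L (f n a b)}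

lemma one_le_sqrt_natCast {n : ℕ} (hn : 1 ≤ n) : 1 ≤ √(n : ℝ) :=
  Real.one_le_sqrt.2 (by exact_mod_cast hn)

namespace WeightBdd

variable {mom : ℕ → ℝ} {E : NoisePoly →ₗ[ℝ] ℝ} {f g : ℕ → ℕ → ℕ → NoisePoly}

lemma const (r : ℝ) : WeightBdd E (fun _ _ _ => MvPolynomial.C r) := fun q => by
  have h0 : ∀ L : List (Sym2 ℕ), ∀ e, edgeDeriv e (iterD L (MvPolynomial.C r)) = 0 := by
    intro L
    induction L with
    | nil => intro e; exact MvPolynomial.pderiv_C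
    | cons e' L ih => intro e; simp [ih]
  intro p
  refine ⟨max |E (MvPolynomial.C r ^ (2 * p))| |E (0 ^ (2 * p))|, ?_⟩
  rintro _ ⟨n, a, b, L, c, -, -, hc, rfl⟩
  cases L with
  | nil =>
    refine le_max_of_le_left ?_
    rw [iterD_nil, smul_pow, map_smul, smul_eq_mul]
    refine (le_abs_self _).trans ?_
    rw [abs_mul]
    refine mul_le_of_le_one_left (abs_nonneg _) ?_
    rw [edgeWeight_nil, pow_zero] at hc
    rw [abs_pow]
    exact pow_le_one₀ (abs_nonneg _) hc
  | cons e L =>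
    refine le_max_of_le_right ?_
    rw [iterD_cons, h0, smul_zero]
    exact le_abs_self _

lemma add (hE : IsNoiseExpectation mom E) (hf : WeightBdd E f) (hg : WeightBdd E g) :
    WeightBdd E (fun n a b => f n a b + g n a b) := fun r => by
  refine ((hf r).add hE (hg r)).mono ?_
  rintro _ ⟨n, a, b, L, c, hn, hL, hc, rfl⟩
  rw [map_add, smul_add]
  exact Set.add_mem_add ⟨n, a, b, L, c, hn, hL, hc, rfl⟩ ⟨n, a, b, L, c, hn, hL, hc, rfl⟩

lemma mul (hE : IsNoiseExpectation mom E) (hf : WeightBdd E f) (hg : WeightBdd E g) :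
    WeightBdd E (fun n a b => f n a b * g n a b) := fun r => by
  refine (((hf r).mul hE (hg r)).sum hE (2 ^ r)).mono ?_
  rintro _ ⟨n, a, b, L, c, hn, hL, hc, rfl⟩
  have hs := one_le_sqrt_natCast hn
  refine ⟨Fin (listSplits L).length, Finset.univ, fun i => c • (iterD (listSplits L)[i].1 (f n a b) *
    iterD (listSplits L)[i].2 (g n a b)), ?_, ?_, ?_⟩
  · rw [Finset.card_univ, Fintype.card_fin, length_listSplits]
    exact Nat.pow_le_pow_right (by norm_num) hL
  · intro i _
    have hmem : (listSplits L)[i] ∈ listSplits L := List.getElem_mem _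
    beta_reduce
    generalize (listSplits L)[i] = s at hmem ⊢
    have hl := length_of_mem_listSplits hmem
    have hpos : (0 : ℝ) < √(n : ℝ) ^ edgeWeight a b s.1 := by positivity
    -- The scalar is divided between the factors: the first gets its full weight, and subadditivity
    -- of the weight leaves enough for the second.
    have : c • (iterD s.1 (f n a b) * iterD s.2 (g n a b)) =
        (√(n : ℝ) ^ edgeWeight a b s.1 • iterD s.1 (f n a b)) *
          ((c / √(n : ℝ) ^ edgeWeight a b s.1) • iterD s.2 (g n a b)) := by
      rw [smul_mul_smul_comm, mul_div_cancel₀ _ hpos.ne']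
    rw [this]
    refine Set.mul_mem_mul ⟨n, a, b, s.1, _, hn, by omega, ?_, rfl⟩
      ⟨n, a, b, s.2, _, hn, by omega, ?_, rfl⟩
    · rw [abs_of_pos hpos]
    · rw [abs_div, abs_of_pos hpos, div_le_iff₀ hpos, ← pow_add]
      refine hc.trans (pow_le_pow_right₀ hs ?_)
      have := edgeWeight_le_add_of_mem_listSplits a b hmem
      omega
  · rw [iterD_mul, ← Finset.smul_sum]
    congr 1
    rw [← Fin.sum_univ_fun_getElem]
    rfl

lemma aeval (hE : IsNoiseExpectation mom E) {σ : Type} {m : ℕ → ℕ → ℕ → σ → NoisePoly}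
    (hm : ∀ i, WeightBdd E (fun n a b => m n a b i)) (p : MvPolynomial σ ℝ) :
    WeightBdd E (fun n a b => MvPolynomial.aeval (m n a b) p) := by
  induction p using MvPolynomial.induction_on with
  | C r => simpa using const r
  | add p q hp hq => simpa using hp.add hE hq
  | mul_X p i hp => simpa using hp.mul hE (hm i)

/-- Divergence bound with weights. -/
lemma momentBdd_noiseSum (hE : IsNoiseExpectation mom E) (hf : WeightBdd E f) (r : ℕ) :
    MomentBdd E {x | ∃ (n a : ℕ) (s : Finset ℕ) (L : List (Sym2 ℕ)) (c : ℝ) (w : ℕ), 1 ≤ n ∧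
      s.card ≤ n ∧ a ∉ s ∧ L.length ≤ r ∧ |c| ≤ √(n : ℝ) ^ w ∧
      (∀ k ∈ s, ∀ l : List ℕ, w + l.length ≤ edgeWeight k a ((l.map fun c => s(a, c)) ++ L)) ∧
      x = c • (√(n : ℝ))⁻¹ • ∑ k ∈ s, noiVar s(a, k) * iterD L (f n k a)} := by
  -- All data form one index type, so the divergence theorem gives one constant for all of them.
  let ι : Type := {p : ℕ × ℕ × Finset ℕ × List (Sym2 ℕ) × ℝ × ℕ //
    1 ≤ p.1 ∧ p.2.2.1.card ≤ p.1 ∧ p.2.1 ∉ p.2.2.1 ∧ p.2.2.2.1.length ≤ r ∧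
    |p.2.2.2.2.1| ≤ √(p.1 : ℝ) ^ p.2.2.2.2.2 ∧ ∀ k ∈ p.2.2.1, ∀ l : List ℕ,
      p.2.2.2.2.2 + l.length ≤
        edgeWeight k p.2.1 ((l.map fun c => s(p.2.1, c)) ++ p.2.2.2.1)}
  let γ : ι → SumCtx := fun i => ⟨i.1.1, i.1.2.1, i.1.2.2.1, i.2.2.1, i.2.2.2.1⟩
  let y : (Σ i, (γ i).verts) → NoisePoly := fun x =>
    x.1.1.2.2.2.2.1 • iterD x.1.1.2.2.2.1 (f x.1.1.1 x.2 x.1.1.2.1)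
  have hy : ∀ q, SmoothBdd E q (fun x : Σ i, (γ i).verts => γ x.1) y := by
    intro q
    -- The condition on `l` says that `k` further derivatives along edges at `a` raise the available
    -- weight by at least `k`, which pays for the factor `√n ^ k`.
    refine SmoothBdd.of_iterD fun k _ => (hf (k + r)).mono ?_
    rintro _ ⟨⟨⟨⟨n, a, s, L, c, w⟩, h1, h2, h3, h4, h5, h6⟩, v, hv⟩, l, hl, -, rfl⟩
    refine ⟨n, v, a, (l.map fun c => s(a, c)) ++ L, √(n : ℝ) ^ k * c, h1, ?_, ?_, ?_⟩
    · simp only [List.length_append, List.length_map]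
      simp only at h4
      omega
    · rw [abs_mul, abs_of_nonneg (by positivity)]
      refine (mul_le_mul_of_nonneg_left h5 (by positivity)).trans ?_
      rw [← pow_add]
      refine pow_le_pow_right₀ (one_le_sqrt_natCast h1) ?_
      have := h6 v hv l
      simp only at this ⊢
      omega
    · simp only [γ, y, map_smul, smul_smul, iterD_append]
  refine (SmoothBdd.momentBdd_noiseSum hE hy).mono ?_
  rintro _ ⟨n, a, s, L, c, w, h1, h2, h3, h4, h5, h6, rfl⟩
  refine ⟨⟨⟨n, a, s, L, c, w⟩, h1, h2, h3, h4, h5, h6⟩, ?_⟩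
  simp only [noiseSum, γ, y]
  rw [smul_comm, Finset.smul_sum, ← Finset.sum_coe_sort s]
  simp only [mul_smul_comm, Finset.smul_sum]

/-- Bound for sums of observations with weights. -/
lemma momentBdd_obsSum (hE : IsNoiseExpectation mom E) (hf : WeightBdd E f) (r : ℕ) :
    MomentBdd E {x | ∃ (n a : ℕ) (s : Finset ℕ) (L : List (Sym2 ℕ)) (c : ℝ) (w : ℕ), 1 ≤ n ∧
      s.card ≤ n ∧ a ∉ s ∧ L.length ≤ r ∧ |c| ≤ √(n : ℝ) ^ w ∧
      (∀ k ∈ s, ∀ l : List ℕ, w + l.length ≤ edgeWeight k a ((l.map fun c => s(a, c)) ++ L)) ∧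
      x = c • (√(n : ℝ))⁻¹ • ∑ k ∈ s, obsPoly n a k * iterD L (f n k a)} := by
  refine ((((hE.momentBdd_sigVar.mul hE hE.momentBdd_sigVar).mul hE (hf r)).avg hE).add hE
    (momentBdd_noiseSum hE hf r)).mono ?_
  rintro _ ⟨n, a, s, L, c, w, h1, h2, h3, h4, h5, h6, rfl⟩
  have hn : (0 : ℝ) ≤ n := by positivity
  -- The signal part of the observation brings a second `n^{-1/2}` and becomes a plain average; only
  -- the noise part needs the divergence bound.
  have : c • (√(n : ℝ))⁻¹ • ∑ k ∈ s, obsPoly n a k * iterD L (f n k a) =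
      (n : ℝ)⁻¹ • ∑ k ∈ s, (sigVar a * sigVar k) * (c • iterD L (f n k a)) +
      c • (√(n : ℝ))⁻¹ • ∑ k ∈ s, noiVar s(a, k) * iterD L (f n k a) := by
    simp only [obsPoly, add_mul, Finset.sum_add_distrib, smul_add, smul_mul_assoc,
      ← Finset.smul_sum, mul_smul_comm, smul_smul]
    congr 2
    rw [← mul_inv, Real.mul_self_sqrt hn, mul_comm]
  rw [this]
  refine Set.add_mem_add ⟨ℕ, s, _, n, h2, fun k hk => Set.mul_mem_mul
    (Set.mul_mem_mul ⟨a, rfl⟩ ⟨k, rfl⟩) ⟨n, k, a, L, c, h1, h4, ?_, rfl⟩, rfl⟩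
    ⟨n, a, s, L, c, w, h1, h2, h3, h4, h5, h6, rfl⟩
  refine h5.trans (pow_le_pow_right₀ (one_le_sqrt_natCast h1) ?_)
  simpa using h6 k hk []

end WeightBdd

lemma IsNoiseExpectation.momentBdd_obsPoly {mom : ℕ → ℝ} {E : NoisePoly →ₗ[ℝ] ℝ}
    (hE : IsNoiseExpectation mom E) :
    MomentBdd E {x | ∃ n a k : ℕ, 1 ≤ n ∧ a ≠ k ∧ x = obsPoly n a k} := by
  refine (((hE.momentBdd_sigVar.mul hE hE.momentBdd_sigVar).smul hE 1).add hE
    hE.momentBdd_noiVar).mono ?_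
  rintro _ ⟨n, a, k, hn, hak, rfl⟩
  refine Set.add_mem_add ⟨_, _, Set.mul_mem_mul ⟨a, rfl⟩ ⟨k, rfl⟩, ?_, rfl⟩ ⟨_, ?_, rfl⟩
  · rw [abs_of_nonneg (by positivity)]
    exact inv_le_one_of_one_le₀ (one_le_sqrt_natCast hn)
  · simpa using hak

lemma iterD_obsPoly_mul (n a k : ℕ) (L : List (Sym2 ℕ)) (f : NoisePoly) :
    iterD L (obsPoly n a k * f) = obsPoly n a k * iterD L f +
      (L.count s(a, k) : ℝ) • iterD (L.erase s(a, k)) f := by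
  simp only [obsPoly, add_mul, map_add, smul_mul_assoc, map_smul, mul_assoc, iterD_sigVar_mul,
    iterD_noiVar_mul, add_assoc]

lemma card_filter_mem_edges_le (s : Finset ℕ) (L : List (Sym2 ℕ)) :
    (s.filter fun k => ∃ e ∈ L, k ∈ e).card ≤ 2 * L.length := by
  have h1 : (s.filter fun k => ∃ e ∈ L, k ∈ e) ⊆ L.toFinset.biUnion Sym2.toFinset := by
    intro k hk
    simpa [Sym2.mem_toFinset] using (Finset.mem_filter.1 hk).2
  refine (Finset.card_le_card h1).trans ((Finset.card_biUnion_le_card_mul _ _ 2 ?_).trans ?_)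
  · intro e _
    rw [Sym2.card_toFinset]
    split_ifs <;> omega
  · rw [mul_comm]
    exact Nat.mul_le_mul_left 2 (List.toFinset_card_le L)

lemma mul_inv_sqrt_le {n m w : ℕ} {c : ℝ} (hn : 1 ≤ n) (hc : |c| ≤ √(n : ℝ) ^ w)
    (h : w ≤ m + 1) : |c * (√(n : ℝ))⁻¹| ≤ √(n : ℝ) ^ m := by
  have hs := one_le_sqrt_natCast hn
  have hs0 : 0 < √(n : ℝ) := by linarith
  rw [abs_mul, abs_of_pos (inv_pos.2 hs0), ← div_eq_mul_inv, div_le_iff₀ hs0, ← pow_succ]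
  exact hc.trans (pow_le_pow_right₀ hs h)

/-- The message recursion preserves weighted bounds. -/
lemma WeightBdd.msgStep {mom : ℕ → ℝ} {E : NoisePoly →ₗ[ℝ] ℝ} {f : ℕ → ℕ → ℕ → NoisePoly}
    (hE : IsNoiseExpectation mom E) (hf : WeightBdd E f) : WeightBdd E (msgStep f) := fun r => by
  refine ((MomentBdd.singleton 0).union (((hf.momentBdd_obsSum hE r).add hE
    ((hE.momentBdd_obsPoly.mul hE (hf r)).sum hE (2 * r))).add hE
    (((((MomentBdd.singleton 0).union (hf r)).smul hE r).sum hE (2 * r))))).mono ?_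
  rintro _ ⟨n, a, b, L, c, hn, hL, hc, rfl⟩
  by_cases hab : a = b
  · left; simp [_root_.msgStep, hab]
  right
  set S := Finset.range n \ {a, b} with hS
  -- At most `2r` vertices are touched by `L`, so their terms are bounded one by one. Only the sum
  -- over untouched vertices needs cancellation.
  set S2 := S.filter fun k => ∃ e ∈ L, k ∈ e with hS2
  set S1 := S.filter fun k => ¬ ∃ e ∈ L, k ∈ e with hS1
  have hS2c : S2.card ≤ 2 * r := (card_filter_mem_edges_le S L).trans (by omega)
  have hSmem : ∀ k ∈ S, k ≠ a ∧ k ≠ b := by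
    intro k hk
    simpa using (Finset.mem_sdiff.1 hk).2
  have hScard : S.card ≤ n := by
    simpa using Finset.card_le_card (Finset.sdiff_subset (s := Finset.range n) (t := {a, b}))
  have hsplit : c • iterD L (_root_.msgStep f n a b) =
      c • (√(n : ℝ))⁻¹ • ∑ k ∈ S1, obsPoly n a k * iterD L (f n k a) +
      ∑ k ∈ S2, obsPoly n a k * ((c * (√(n : ℝ))⁻¹) • iterD L (f n k a)) +
      ∑ k ∈ S2, (L.count s(a, k) : ℝ) • (c * (√(n : ℝ))⁻¹) •
        iterD (L.erase s(a, k)) (f n k a) := by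
    rw [_root_.msgStep, if_neg hab, map_smul, map_sum]
    simp only [iterD_obsPoly_mul, Finset.sum_add_distrib]
    rw [← Finset.sum_filter_not_add_sum_filter S (fun k => ∃ e ∈ L, k ∈ e)
      (fun k => obsPoly n a k * iterD L (f n k a))]
    have h0 : ∑ k ∈ S, (L.count s(a, k) : ℝ) • iterD (L.erase s(a, k)) (f n k a) =
        ∑ k ∈ S2, (L.count s(a, k) : ℝ) • iterD (L.erase s(a, k)) (f n k a) := by
      symm
      refine Finset.sum_subset (Finset.filter_subset _ _) fun k hk hk2 => ?_
      rw [List.count_eq_zero_of_not_mem, Nat.cast_zero, zero_smul]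
      intro hmem
      exact hk2 (Finset.mem_filter.2 ⟨hk, s(a, k), hmem, by simp⟩)
    rw [h0]
    simp only [smul_add, mul_smul_comm, Finset.smul_sum, smul_smul]
    congr 1
    refine Finset.sum_congr rfl fun k _ => ?_
    congr 1
    ring
  rw [hsplit]
  refine Set.add_mem_add (Set.add_mem_add ?_ ⟨ℕ, S2, _, hS2c, ?_, rfl⟩) ⟨ℕ, S2, _, hS2c, ?_, rfl⟩
  · refine ⟨n, a, S1, L, c, edgeWeight a b L, hn, (Finset.card_filter_le _ _).trans hScard, ?_, hL,
      hc, ?_, rfl⟩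
    · intro h
      exact (hSmem a (Finset.mem_filter.1 h).1).1 rfl
    · intro k hk l
      obtain ⟨hkS, hkL⟩ := Finset.mem_filter.1 hk
      have h1 := length_le_edgeWeight k a ((l.map fun c => s(a, c)) ++ L)
      rw [List.length_append, List.length_map] at h1
      -- For untouched `k`, no edge of `L` contains `k`, and an edge `s(a, c)` contains `k` only if
      -- it is `s(k, a)`, which is not direct for `k → a`. So the extra unit required by `a → b` is
      -- present for `k → a`.
      by_cases hw : L ≠ [] ∧ ∀ e ∈ L, ¬ (a ∈ e ∧ e ≠ s(a, b))
      · rw [edgeWeight_of_forall (L := (l.map fun c => s(a, c)) ++ L), edgeWeight_of_forall hw.1 hw.2]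
        · simp only [List.length_append, List.length_map]; omega
        · simp [hw.1]
        · rintro e he ⟨hke, hne⟩
          rcases List.mem_append.1 he with he | he
          · obtain ⟨v, -, rfl⟩ := List.mem_map.1 he
            rcases Sym2.mem_iff.1 hke with rfl | rfl
            · exact (hSmem k hkS).1 rfl
            · exact hne Sym2.eq_swap
          · exact hkL ⟨e, he, hke⟩
      · have h2 : edgeWeight a b L = L.length := by rw [edgeWeight, if_neg hw, add_zero]
        omega
  · intro k hk
    obtain ⟨hkS, -⟩ := Finset.mem_filter.1 hk
    refine Set.mul_mem_mul ⟨n, a, k, hn, (hSmem k hkS).1.symm, rfl⟩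
      ⟨n, k, a, L, _, hn, hL, mul_inv_sqrt_le hn hc ?_, rfl⟩
    -- The prefactor `n^{-1/2}` pays for the extra unit that `k → a` may lack.
    exact (edgeWeight_le a b L).trans (Nat.add_le_add_right (length_le_edgeWeight k a L) 1)
  · intro k hk
    obtain ⟨hkS, -⟩ := Finset.mem_filter.1 hk
    by_cases hmem : s(a, k) ∈ L
    · refine ⟨_, _, Or.inr ⟨n, k, a, L.erase s(a, k), _, hn, (List.length_erase_le).trans hL,
        mul_inv_sqrt_le hn hc ?_, rfl⟩, ?_, rfl⟩
      -- An edge `s(a, k)` with `k ≠ b` enters `a → b` directly, so no extra unit is required; the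
      -- prefactor `n^{-1/2}` makes up for the erased edge.
      · rw [edgeWeight_of_mem hmem (by simp) (by
          intro h
          rcases Sym2.eq_iff.1 h with ⟨-, h⟩ | ⟨h, -⟩
          · exact (hSmem k hkS).2 h
          · exact hab h)]
        have h1 := length_le_edgeWeight k a (L.erase s(a, k))
        rw [List.length_erase_of_mem hmem] at h1
        omega
      · rw [abs_of_nonneg (by positivity)]
        exact_mod_cast List.count_le_length.trans hL
    · refine ⟨0, 0, Or.inl rfl, by simp, ?_⟩
      rw [List.count_eq_zero_of_not_mem hmem]
      simp

/-- Weighted derivative bounds for the messages. -/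
theorem weightBdd_msgPoly {mom : ℕ → ℝ} {E : NoisePoly →ₗ[ℝ] ℝ} (hE : IsNoiseExpectation mom E)
    {d : ℕ} (F : ℕ → Fin d → MvPolynomial (Fin d) ℝ) (t : ℕ) (α : Fin d) :
    WeightBdd E (fun n a b => msgPoly F t n a b α) := by
  induction t generalizing α with
  | zero => simpa [msgPoly] using WeightBdd.const (E := E) 0
  | succ t ih => exact (WeightBdd.aeval hE ih (F t α)).msgStep hE
end

noncomputable section

open scoped Pointwise

/-! ### Approximate Stein identity for the messages -/

lemma Derivation.map_mvPolynomial_aeval {σ A : Type} [Fintype σ] [CommRing A] [Algebra ℝ A]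
    (D : Derivation ℝ A A) (g : σ → A) (p : MvPolynomial σ ℝ) :
    D (MvPolynomial.aeval g p) =
      ∑ i, MvPolynomial.aeval g (MvPolynomial.pderiv i p) * D (g i) := by
  classical
  induction p using MvPolynomial.induction_on with
  | C r => simp
  | add p q hp hq => simp [hp, hq, add_mul, Finset.sum_add_distrib]
  | mul_X p i hp =>
    rw [map_mul, Derivation.leibniz, hp, MvPolynomial.aeval_X]
    simp only [smul_eq_mul, MvPolynomial.pderiv_mul, map_add, map_mul, MvPolynomial.aeval_X,
      add_mul, Finset.sum_add_distrib, MvPolynomial.pderiv_X, Pi.single_apply]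
    rw [add_comm, Finset.mul_sum]
    congr 1
    · exact Finset.sum_congr rfl fun j _ => by ring
    · rw [Finset.sum_eq_single i]
      · simp
      · intro j _ hj; simp [hj.symm]
      · simp

/-- The test polynomial `φ` evaluated at the message `a → b` and the signal at `a`. -/
def testPoly {d : ℕ} (F : ℕ → Fin d → MvPolynomial (Fin d) ℝ) (t : ℕ)
    (φ : MvPolynomial (Fin d ⊕ Unit) ℝ) (n a b : ℕ) : NoisePoly :=
  MvPolynomial.aeval (Sum.elim (msgPoly F t n a b) fun _ => sigVar a) φ

/-- Indices of two messages with distinct sources. -/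
structure PairIdx where
  n : ℕ
  a : ℕ
  b : ℕ
  a' : ℕ
  b' : ℕ
  ha : a < n
  hb : b < n
  ha' : a' < n
  hb' : b' < n
  hab : a ≠ b
  hab' : a' ≠ b'
  haa' : a ≠ a'

namespace PairIdx

/-- Exchange the two messages. -/
def swap (i : PairIdx) : PairIdx :=
  ⟨i.n, i.a', i.b', i.a, i.b, i.ha', i.hb', i.ha, i.hb, i.hab', i.hab, i.haa'.symm⟩

/-- Convergence along a large dimension, uniformly over the indices. -/
def large : Filter PairIdx := comap PairIdx.n atTop

lemma tendsto_swap : Tendsto swap large large :=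
  tendsto_comap_iff.2 tendsto_comap

lemma one_le (i : PairIdx) : 1 ≤ i.n := Nat.one_le_of_lt i.ha

/-- The other vertices than the source and the target of the first message. -/
def others (i : PairIdx) : Finset ℕ := Finset.range i.n \ {i.a, i.b}

lemma mem_others {i : PairIdx} {k : ℕ} : k ∈ i.others ↔ k < i.n ∧ k ≠ i.a ∧ k ≠ i.b := by
  simp [others]

lemma card_others (i : PairIdx) : (i.others.card : ℝ) = i.n - 2 := by
  have h : ({i.a, i.b} : Finset ℕ) ⊆ Finset.range i.n := by
    intro k hk
    simp only [Finset.mem_insert, Finset.mem_singleton] at hk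
    rcases hk with rfl | rfl
    · simpa using i.ha
    · simpa using i.hb
  rw [others, Finset.cast_card_sdiff h, Finset.card_pair i.hab]
  simp

lemma card_others_le (i : PairIdx) : i.others.card ≤ i.n := by
  simpa only [Finset.card_range, others] using
    Finset.card_le_card (Finset.sdiff_subset (s := Finset.range i.n) (t := {i.a, i.b}))

lemma tendsto_n : Tendsto (fun i : PairIdx => (i.n : ℝ)) large atTop :=
  tendsto_natCast_atTop_atTop.comp tendsto_comap

lemma tendsto_zero_of_le_div_sqrt {g : PairIdx → ℝ} {C : ℝ}
    (h : ∀ i, |g i| ≤ C * (√(i.n : ℝ))⁻¹) : Tendsto g large (𝓝 0) := by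
  refine squeeze_zero_norm h ?_
  have h1 : Tendsto (fun i : PairIdx => (√(i.n : ℝ))⁻¹) large (𝓝 0) :=
    (Real.tendsto_sqrt_atTop.comp tendsto_n).inv_tendsto_atTop
  simpa using h1.const_mul C

end PairIdx

/-- Cauchy–Schwarz, from the nonpositive discriminant of `x ↦ E[(x u + v)²]`. -/
lemma IsNoiseExpectation.sq_expect_mul_le {mom : ℕ → ℝ} {E : NoisePoly →ₗ[ℝ] ℝ}
    (hE : IsNoiseExpectation mom E) (u v : NoisePoly) :
    E (u * v) ^ 2 ≤ E (u ^ 2) * E (v ^ 2) := by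
  have h : ∀ x : ℝ, 0 ≤ E (u ^ 2) * (x * x) + (2 * E (u * v)) * x + E (v ^ 2) := by
    intro x
    have h1 : 0 ≤ E ((x • u + v) ^ 2) := by
      simpa using hE.even_nonneg (x • u + v) 1
    have h2 : (x • u + v) ^ 2 = (x * x) • u ^ 2 + (2 * x) • (u * v) + v ^ 2 := by
      simp only [MvPolynomial.smul_eq_C_mul, map_mul, map_ofNat]; ring
    rw [h2] at h1
    simp only [map_add, map_smul, smul_eq_mul] at h1
    linarith
  have := discrim_le_zero h
  rw [discrim] at this
  nlinarith

/-- Cauchy–Schwarz: a bounded factor times a vanishing factor has vanishing expectation. -/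
lemma IsNoiseExpectation.tendsto_expect_mul {mom : ℕ → ℝ} {E : NoisePoly →ₗ[ℝ] ℝ}
    (hE : IsNoiseExpectation mom E) {u v : PairIdx → NoisePoly}
    (hu : MomentBdd E (Set.range u))
    (hv : Tendsto (fun i => E (v i ^ 2)) PairIdx.large (𝓝 0)) :
    Tendsto (fun i => E (u i * v i)) PairIdx.large (𝓝 0) := by
  obtain ⟨C, -, hC⟩ := hu.exists_pos 1
  have h1 : Tendsto (fun i => E (u i * v i) ^ 2) PairIdx.large (𝓝 0) := by
    refine squeeze_zero (fun i => sq_nonneg _) (fun i => (hE.sq_expect_mul_le _ _).trans ?_)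
      (by simpa using hv.const_mul C)
    refine mul_le_mul_of_nonneg_right (by simpa using hC _ ⟨i, rfl⟩) ?_
    simpa using hE.even_nonneg (v i) 1
  have h2 := (Real.continuous_sqrt.tendsto 0).comp h1
  simp only [Real.sqrt_zero, Function.comp_def, Real.sqrt_sq_eq_abs] at h2
  exact (tendsto_zero_iff_abs_tendsto_zero _).2 h2

/-- A sum of `n` terms of order `1 / n` against the factor `n ^ (-1/2)` vanishes. -/
lemma IsNoiseExpectation.tendsto_sum_of_momentBdd {mom : ℕ → ℝ} {E : NoisePoly →ₗ[ℝ] ℝ}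
    (hE : IsNoiseExpectation mom E) (u : PairIdx → ℕ → NoisePoly)
    (hu : MomentBdd E {x | ∃ i, ∃ k ∈ i.others, k ≠ i.a' ∧ x = (i.n : ℝ) • u i k})
    (hu' : MomentBdd E {x | ∃ i, ∃ k ∈ i.others, x = √(i.n : ℝ) • u i k}) :
    Tendsto (fun i => (√(i.n : ℝ))⁻¹ * ∑ k ∈ i.others, E (u i k)) PairIdx.large (𝓝 0) := by
  obtain ⟨C, hC0, hC⟩ := hu.abs_expect_le hE
  obtain ⟨D, hD0, hD⟩ := hu'.abs_expect_le hE
  refine PairIdx.tendsto_zero_of_le_div_sqrt (C := C + D) fun i => ?_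
  have hn : (0 : ℝ) < i.n := by exact_mod_cast i.one_le
  have hs := one_le_sqrt_natCast i.one_le
  -- The single vertex `k = a'` escapes the bound of order `1 / n`, since `s(a, a')` may enter the
  -- second message directly. One bounded term is harmless.
  have h1 : ∀ k ∈ i.others, |E (u i k)| ≤ C / i.n + if k = i.a' then D else 0 := by
    intro k hk
    by_cases h : k = i.a'
    · have := hD _ ⟨i, k, hk, rfl⟩
      rw [map_smul, smul_eq_mul, abs_mul, abs_of_nonneg (by positivity)] at this
      rw [if_pos h]
      have h2 : |E (u i k)| ≤ D := (le_mul_of_one_le_left (abs_nonneg _) hs).trans this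
      have h3 : 0 ≤ C / i.n := by positivity
      linarith
    · have := hC _ ⟨i, k, hk, h, rfl⟩
      rw [map_smul, smul_eq_mul, abs_mul, abs_of_pos hn] at this
      rw [if_neg h, add_zero, le_div_iff₀ hn]
      linarith
  have h2 : |∑ k ∈ i.others, E (u i k)| ≤ C + D := by
    refine (Finset.abs_sum_le_sum_abs _ _).trans ((Finset.sum_le_sum h1).trans ?_)
    rw [Finset.sum_add_distrib, Finset.sum_ite_eq', Finset.sum_const, nsmul_eq_mul]
    refine add_le_add ?_ (by split_ifs <;> linarith)
    rw [mul_div_assoc', div_le_iff₀ hn, mul_comm]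
    exact mul_le_mul_of_nonneg_left (by exact_mod_cast i.card_others_le) hC0.le
  rw [abs_mul, abs_of_pos (by positivity), mul_comm]
  exact mul_le_mul_of_nonneg_right h2 (by positivity)

section Stein

variable {mom : ℕ → ℝ} {E : NoisePoly →ₗ[ℝ] ℝ} {d : ℕ}

lemma weightBdd_sigVar (hE : IsNoiseExpectation mom E) :
    WeightBdd E (fun _ a _ => sigVar a) := fun r => by
  refine (((MomentBdd.singleton 0).union hE.momentBdd_sigVar).smul hE 1).mono ?_
  rintro _ ⟨n, a, b, L, c, -, -, hc, rfl⟩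
  cases L with
  | nil => exact ⟨c, _, Or.inr ⟨a, rfl⟩, by simpa [edgeWeight_nil] using hc, by simp⟩
  | cons e L =>
    refine ⟨0, 0, Or.inl rfl, by simp, ?_⟩
    have : iterD (e :: L) (sigVar a * 1) = sigVar a * iterD (e :: L) 1 := iterD_sigVar_mul _ _ _
    have h0 : ∀ L : List (Sym2 ℕ), ∀ e, edgeDeriv e (iterD L (1 : NoisePoly)) = 0 := by
      intro L
      induction L with
      | nil => intro e; simp
      | cons e' L ih => intro e; simp [ih]
    rw [mul_one, iterD_cons e L 1, h0, mul_zero] at this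
    rw [this]; simp

lemma weightBdd_testPoly (hE : IsNoiseExpectation mom E)
    (F : ℕ → Fin d → MvPolynomial (Fin d) ℝ) (t : ℕ) (φ : MvPolynomial (Fin d ⊕ Unit) ℝ) :
    WeightBdd E (testPoly F t φ) := by
  refine WeightBdd.aeval hE (m := fun n a b => Sum.elim (msgPoly F t n a b) fun _ => sigVar a) ?_ φ
  rintro (α | _)
  · exact weightBdd_msgPoly hE F t α
  · exact weightBdd_sigVar hE

lemma WeightBdd.momentBdd_range {f : ℕ → ℕ → ℕ → NoisePoly}
    (hf : WeightBdd E f) : MomentBdd E {x | ∃ n a b, 1 ≤ n ∧ x = f n a b} := by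
  refine (hf 0).mono ?_
  rintro _ ⟨n, a, b, hn, rfl⟩
  exact ⟨n, a, b, [], 1, hn, by simp, by simp [edgeWeight_nil], by simp⟩

lemma WeightBdd.momentBdd_edgeDeriv {f : ℕ → ℕ → ℕ → NoisePoly}
    (hf : WeightBdd E f) : MomentBdd E {x | ∃ (n a b : ℕ) (e : Sym2 ℕ), 1 ≤ n ∧ x = √(n : ℝ) • edgeDeriv e (f n a b)} := by
  refine (hf 1).mono ?_
  rintro _ ⟨n, a, b, e, hn, rfl⟩
  refine ⟨n, a, b, [e], _, hn, by simp, ?_, rfl⟩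
  rw [abs_of_nonneg (by positivity)]
  exact le_self_pow₀ (one_le_sqrt_natCast hn) (by
    have := length_le_edgeWeight a b [e]; simp at this; omega)

/-- A single edge that does not enter directly has weight `2`, hence a derivative of order `1 / n`.
-/
lemma WeightBdd.momentBdd_edgeDeriv_of_not_proper {f : ℕ → ℕ → ℕ → NoisePoly}
    (hf : WeightBdd E f) : MomentBdd E {x | ∃ (n a b : ℕ) (e : Sym2 ℕ), 1 ≤ n ∧ (a ∈ e → e = s(a, b)) ∧
      x = (n : ℝ) • edgeDeriv e (f n a b)} := by
  refine (hf 1).mono ?_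
  rintro _ ⟨n, a, b, e, hn, he, rfl⟩
  refine ⟨n, a, b, [e], _, hn, by simp, ?_, rfl⟩
  rw [edgeWeight_of_forall (by simp) (by simpa using he), List.length_singleton,
    Real.sq_sqrt (by positivity), abs_of_nonneg (by positivity)]

/-- The step applied to the messages: the nonlinearity at the message `k → a`. -/
def nonlinPoly (F : ℕ → Fin d → MvPolynomial (Fin d) ℝ) (t n k a : ℕ) (α : Fin d) : NoisePoly :=
  MvPolynomial.aeval (msgPoly F t n k a) (F t α)

lemma msgPoly_succ (F : ℕ → Fin d → MvPolynomial (Fin d) ℝ) (t n a b : ℕ) (α : Fin d) :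
    msgPoly F (t + 1) n a b α = msgStep (fun n k a => nonlinPoly F t n k a α) n a b := rfl

lemma weightBdd_nonlinPoly (hE : IsNoiseExpectation mom E)
    (F : ℕ → Fin d → MvPolynomial (Fin d) ℝ) (t : ℕ) (α : Fin d) :
    WeightBdd E (fun n k a => nonlinPoly F t n k a α) :=
  WeightBdd.aeval hE (weightBdd_msgPoly hE F t) (F t α)

/-- The indirect part of the derivative of a message. -/
def indirectDeriv (F : ℕ → Fin d → MvPolynomial (Fin d) ℝ) (t n a b k : ℕ) (α : Fin d) :
    NoisePoly :=
  (√(n : ℝ))⁻¹ • ∑ l ∈ Finset.range n \ {a, b},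
    obsPoly n a l * edgeDeriv s(a, k) (nonlinPoly F t n l a α)

/-- The first term comes from the explicit factor `X_{ak}` in the sum. It is the only contribution
of order `n^{-1/2}` and is the source of the covariance. -/
lemma edgeDeriv_msgPoly (F : ℕ → Fin d → MvPolynomial (Fin d) ℝ) (t n a b k : ℕ) (α : Fin d)
    (hab : a ≠ b) (hk : k ∈ Finset.range n \ {a, b}) :
    edgeDeriv s(a, k) (msgPoly F (t + 1) n a b α) =
      (√(n : ℝ))⁻¹ • nonlinPoly F t n k a α + indirectDeriv F t n a b k α := by
  have h : ∀ l, edgeDeriv s(a, k) (obsPoly n a l * nonlinPoly F t n l a α) =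
      (if l = k then nonlinPoly F t n l a α else 0) +
        obsPoly n a l * edgeDeriv s(a, k) (nonlinPoly F t n l a α) := by
    intro l
    have h1 := iterD_obsPoly_mul n a l [s(a, k)] (nonlinPoly F t n l a α)
    simp only [iterD_cons, iterD_nil] at h1
    rw [h1, add_comm]
    congr 1
    by_cases hlk : l = k
    · subst hlk; simp
    · rw [if_neg hlk, List.count_eq_zero_of_not_mem, Nat.cast_zero, zero_smul]
      rw [List.mem_singleton]
      intro h
      rcases Sym2.eq_iff.1 h with ⟨-, h⟩ | ⟨h, h'⟩
      · exact hlk h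
      · exact hlk (h'.trans h)
  rw [msgPoly_succ, msgStep, if_neg hab, Derivation.map_smul, map_sum, indirectDeriv]
  simp only [h, Finset.sum_add_distrib, smul_add, Finset.sum_ite_eq', if_pos hk]

/-- The message `l → a` avoids `a`, so an edge at `a` never enters it directly and its derivative is
of order `1 / n`. The divergence bound keeps this order after summation over `l`. -/
lemma momentBdd_indirectDeriv (hE : IsNoiseExpectation mom E)
    (F : ℕ → Fin d → MvPolynomial (Fin d) ℝ) (t : ℕ) (α : Fin d) :
    MomentBdd E {x | ∃ n a b k : ℕ, 1 ≤ n ∧ x = (n : ℝ) • indirectDeriv F t n a b k α} := by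
  refine ((weightBdd_nonlinPoly hE F t α).momentBdd_obsSum hE 1).mono ?_
  rintro _ ⟨n, a, b, k, hn, rfl⟩
  refine ⟨n, a, _, [s(a, k)], n, 2, hn, ?_, by simp, by simp, ?_, ?_, rfl⟩
  · simpa using Finset.card_le_card (Finset.sdiff_subset (s := Finset.range n) (t := {a, b}))
  · rw [Real.sq_sqrt (by positivity), abs_of_nonneg (by positivity)]
  · intro v hv l
    have hva : v ≠ a := by
      rintro rfl
      simp at hv
    rw [edgeWeight_of_forall (by simp)]
    · simp; omega
    · have key : ∀ c : ℕ, ¬ (v ∈ s(a, c) ∧ s(a, c) ≠ s(v, a)) := by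
        rintro c ⟨h1, h2⟩
        rcases Sym2.mem_iff.1 h1 with rfl | rfl
        · exact hva rfl
        · exact h2 Sym2.eq_swap
      intro e he
      rcases List.mem_append.1 he with he | he
      · obtain ⟨c, -, rfl⟩ := List.mem_map.1 he
        exact key c
      · rw [List.mem_singleton.1 he]
        exact key k

end Stein
end

/-! ### Integration by parts for a message and its error terms. -/

noncomputable section

open scoped Pointwise

section Stein

variable {mom : ℕ → ℝ} {E : NoisePoly →ₗ[ℝ] ℝ} {d : ℕ}

/-- The test polynomial `F_α`. -/
def liftTest (p : MvPolynomial (Fin d) ℝ) : MvPolynomial (Fin d ⊕ Unit) ℝ :=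
  MvPolynomial.rename Sum.inl p

/-- The test polynomial `θ`. -/
def sigTest : MvPolynomial (Fin d ⊕ Unit) ℝ := MvPolynomial.X (Sum.inr ())

lemma testPoly_mul (F : ℕ → Fin d → MvPolynomial (Fin d) ℝ) (t : ℕ)
    (φ ψ : MvPolynomial (Fin d ⊕ Unit) ℝ) (n a b : ℕ) :
    testPoly F t (φ * ψ) n a b = testPoly F t φ n a b * testPoly F t ψ n a b := map_mul _ _ _

lemma testPoly_sigTest (F : ℕ → Fin d → MvPolynomial (Fin d) ℝ) (t n a b : ℕ) :
    testPoly F t sigTest n a b = sigVar a := by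
  simp [testPoly, sigTest]

lemma testPoly_X_inl (F : ℕ → Fin d → MvPolynomial (Fin d) ℝ) (t n a b : ℕ) (α : Fin d) :
    testPoly F t (MvPolynomial.X (Sum.inl α)) n a b = msgPoly F t n a b α := by
  simp [testPoly]

lemma testPoly_liftTest (F : ℕ → Fin d → MvPolynomial (Fin d) ℝ) (t n a b : ℕ)
    (p : MvPolynomial (Fin d) ℝ) :
    testPoly F t (liftTest p) n a b = MvPolynomial.aeval (msgPoly F t n a b) p := by
  rw [testPoly, liftTest, MvPolynomial.aeval_rename]
  rfl

/-- Empirical averages of test polynomials of the messages into `a` converge in `L²`. -/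
def AvgConcentrates (E : NoisePoly →ₗ[ℝ] ℝ) (F : ℕ → Fin d → MvPolynomial (Fin d) ℝ) (t : ℕ)
    (L : MvPolynomial (Fin d ⊕ Unit) ℝ →ₗ[ℝ] ℝ) : Prop :=
  ∀ ψ, Tendsto (fun i : PairIdx => E (((i.n : ℝ)⁻¹ • ∑ k ∈ i.others, testPoly F t ψ i.n k i.a -
    MvPolynomial.C (L ψ)) ^ 2)) PairIdx.large (𝓝 0)

/-- The approximate Stein identity, with mean `μ` and covariance `S`. -/
def ApproxStein (E : NoisePoly →ₗ[ℝ] ℝ) (F : ℕ → Fin d → MvPolynomial (Fin d) ℝ) (t : ℕ)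
    (μ : Fin d → ℝ) (S : Matrix (Fin d) (Fin d) ℝ) : Prop :=
  ∀ (φ φ' : MvPolynomial (Fin d ⊕ Unit) ℝ) (α : Fin d), Tendsto (fun i : PairIdx =>
    E (testPoly F t (MvPolynomial.X (Sum.inl α) * φ) i.n i.a i.b * testPoly F t φ' i.n i.a' i.b') -
    μ α * E (testPoly F t (sigTest * φ) i.n i.a i.b * testPoly F t φ' i.n i.a' i.b') -
    ∑ β, S α β * E (testPoly F t (MvPolynomial.pderiv (Sum.inl β) φ) i.n i.a i.b *
      testPoly F t φ' i.n i.a' i.b')) PairIdx.large (𝓝 0)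

lemma edgeDeriv_testPoly (F : ℕ → Fin d → MvPolynomial (Fin d) ℝ) (t n a b : ℕ) (e : Sym2 ℕ)
    (φ : MvPolynomial (Fin d ⊕ Unit) ℝ) :
    edgeDeriv e (testPoly F t φ n a b) = ∑ β, testPoly F t (MvPolynomial.pderiv (Sum.inl β) φ) n a b *
      edgeDeriv e (msgPoly F t n a b β) := by
  rw [testPoly, Derivation.map_mvPolynomial_aeval, Fintype.sum_sum_type]
  simp [edgeDeriv_sigVar, testPoly]

/-- Gaussian integration by parts for a message. -/
lemma expect_msgPoly_mul (hE : IsNoiseExpectation mom E)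
    (F : ℕ → Fin d → MvPolynomial (Fin d) ℝ) (t : ℕ) (φ φ' : MvPolynomial (Fin d ⊕ Unit) ℝ)
    (α : Fin d) (μ : ℝ) (S : Fin d → ℝ) (i : PairIdx) :
    E (msgPoly F (t + 1) i.n i.a i.b α * testPoly F (t + 1) φ i.n i.a i.b *
        testPoly F (t + 1) φ' i.n i.a' i.b') -
      μ * E (sigVar i.a * testPoly F (t + 1) φ i.n i.a i.b *
        testPoly F (t + 1) φ' i.n i.a' i.b') -
      ∑ β, S β * E (testPoly F (t + 1) (MvPolynomial.pderiv (Sum.inl β) φ) i.n i.a i.b *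
        testPoly F (t + 1) φ' i.n i.a' i.b') =
    E (sigVar i.a * testPoly F (t + 1) φ i.n i.a i.b * testPoly F (t + 1) φ' i.n i.a' i.b' *
      ((i.n : ℝ)⁻¹ • ∑ k ∈ i.others, testPoly F t (sigTest * liftTest (F t α)) i.n k i.a -
        MvPolynomial.C μ)) +
    ∑ β, E (testPoly F (t + 1) (MvPolynomial.pderiv (Sum.inl β) φ) i.n i.a i.b *
        testPoly F (t + 1) φ' i.n i.a' i.b' *
      ((i.n : ℝ)⁻¹ • ∑ k ∈ i.others, testPoly F t (liftTest (F t α * F t β)) i.n k i.a -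
        MvPolynomial.C (S β))) +
    (√(i.n : ℝ))⁻¹ * ∑ k ∈ i.others, E (edgeDeriv s(i.a, k) (nonlinPoly F t i.n k i.a α) *
      (testPoly F (t + 1) φ i.n i.a i.b * testPoly F (t + 1) φ' i.n i.a' i.b')) +
    (√(i.n : ℝ))⁻¹ * ∑ k ∈ i.others, E (edgeDeriv s(i.a, k) (testPoly F (t + 1) φ' i.n i.a' i.b') *
      (nonlinPoly F t i.n k i.a α * testPoly F (t + 1) φ i.n i.a i.b)) +
    ∑ β, (√(i.n : ℝ))⁻¹ * ∑ k ∈ i.others, E (indirectDeriv F t i.n i.a i.b k β *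
      (nonlinPoly F t i.n k i.a α *
        testPoly F (t + 1) (MvPolynomial.pderiv (Sum.inl β) φ) i.n i.a i.b *
        testPoly F (t + 1) φ' i.n i.a' i.b')) := by
  have hn : (0 : ℝ) ≤ i.n := by positivity
  have hibp : ∀ k ∈ i.others, ∀ f, E (noiVar s(i.a, k) * f) = E (edgeDeriv s(i.a, k) f) := by
    intro k hk f
    refine hE.ibp _ ?_ f
    rw [Sym2.mk_isDiag_iff]
    exact (PairIdx.mem_others.1 hk).2.1.symm
  have hder : ∀ k ∈ i.others, ∀ β, edgeDeriv s(i.a, k) (msgPoly F (t + 1) i.n i.a i.b β) =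
      (√(i.n : ℝ))⁻¹ • nonlinPoly F t i.n k i.a β + indirectDeriv F t i.n i.a i.b k β :=
    fun k hk β => edgeDeriv_msgPoly F t i.n i.a i.b k β i.hab hk
  have hmsg : msgPoly F (t + 1) i.n i.a i.b α =
      (√(i.n : ℝ))⁻¹ • ∑ k ∈ i.others, obsPoly i.n i.a k * nonlinPoly F t i.n k i.a α := by
    rw [msgPoly_succ, msgStep, if_neg i.hab]; rfl
  have hx : ∀ k, MvPolynomial.aeval (msgPoly F t i.n k i.a) (F t α) = nonlinPoly F t i.n k i.a α :=
    fun k => rfl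
  have hx' : ∀ k β, MvPolynomial.aeval (msgPoly F t i.n k i.a) (F t α * F t β) =
      nonlinPoly F t i.n k i.a α * nonlinPoly F t i.n k i.a β := fun k β => map_mul _ _ _
  simp only [testPoly_mul, testPoly_sigTest, testPoly_liftTest, hx, hx', hmsg]
  generalize testPoly F (t + 1) φ' i.n i.a' i.b' = H
  have hΦ : ∀ k ∈ i.others, edgeDeriv s(i.a, k) (testPoly F (t + 1) φ i.n i.a i.b) =
      ∑ β, testPoly F (t + 1) (MvPolynomial.pderiv (Sum.inl β) φ) i.n i.a i.b *
        ((√(i.n : ℝ))⁻¹ • nonlinPoly F t i.n k i.a β + indirectDeriv F t i.n i.a i.b k β) := by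
    intro k hk
    rw [edgeDeriv_testPoly]
    exact Finset.sum_congr rfl fun β _ => by rw [hder k hk β]
  generalize testPoly F (t + 1) φ i.n i.a i.b = Φ at hΦ ⊢
  generalize hΦ' : (fun β => testPoly F (t + 1) (MvPolynomial.pderiv (Sum.inl β) φ) i.n i.a i.b) =
    Φ' at hΦ ⊢
  replace hΦ' : ∀ β, testPoly F (t + 1) (MvPolynomial.pderiv (Sum.inl β) φ) i.n i.a i.b = Φ' β :=
    fun β => congrFun hΦ' β
  simp only [hΦ'] at hΦ ⊢
  generalize nonlinPoly F t i.n = x at hΦ ⊢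
  generalize indirectDeriv F t i.n i.a i.b = V at hΦ ⊢
  -- Splitting the observation: the rank-one part yields the empirical average for the mean, and the
  -- noise part is integrated by parts.
  have h1 : E ((√(i.n : ℝ))⁻¹ • (∑ k ∈ i.others, obsPoly i.n i.a k * x k i.a α) * Φ * H) =
      (i.n : ℝ)⁻¹ * ∑ k ∈ i.others, E (sigVar i.a * Φ * H * (sigVar k * x k i.a α)) +
      (√(i.n : ℝ))⁻¹ * ∑ k ∈ i.others, E (edgeDeriv s(i.a, k) (x k i.a α * Φ * H)) := by
    have h2 : (i.n : ℝ)⁻¹ = (√(i.n : ℝ))⁻¹ * (√(i.n : ℝ))⁻¹ := by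
      rw [← mul_inv, Real.mul_self_sqrt hn]
    rw [h2, mul_assoc _ (√(i.n : ℝ))⁻¹ (∑ k ∈ i.others, _), ← mul_add, Finset.mul_sum,
      ← Finset.sum_add_distrib, smul_mul_assoc, smul_mul_assoc, map_smul, smul_eq_mul,
      Finset.sum_mul, Finset.sum_mul, map_sum]
    congr 1
    refine Finset.sum_congr rfl fun k hk => ?_
    rw [← hibp k hk, ← smul_eq_mul (a := (√(i.n : ℝ))⁻¹), ← map_smul, ← map_add]
    congr 1
    simp only [obsPoly, MvPolynomial.smul_eq_C_mul]
    ring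
  -- The derivative falls on the nonlinearity, on the second message, or on the first. In the last
  -- case the direct term gives the empirical average for the covariance.
  have h3 : ∀ k ∈ i.others, E (edgeDeriv s(i.a, k) (x k i.a α * Φ * H)) =
      E (edgeDeriv s(i.a, k) (x k i.a α) * (Φ * H)) +
      E (edgeDeriv s(i.a, k) H * (x k i.a α * Φ)) +
      ∑ β, ((√(i.n : ℝ))⁻¹ * E (Φ' β * H * (x k i.a α * x k i.a β)) +
        E (V k β * (x k i.a α * Φ' β * H))) := by
    intro k hk
    rw [edgeDeriv_mul, edgeDeriv_mul, hΦ k hk, ← map_add]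
    simp only [← smul_eq_mul (a := (√(i.n : ℝ))⁻¹), ← map_smul, ← map_add, ← map_sum]
    congr 1
    have : ∀ β, (√(i.n : ℝ))⁻¹ • (Φ' β * H * (x k i.a α * x k i.a β)) +
        V k β * (x k i.a α * Φ' β * H) =
        x k i.a α * H * (Φ' β * ((√(i.n : ℝ))⁻¹ • x k i.a β + V k β)) := by
      intro β
      simp only [MvPolynomial.smul_eq_C_mul]
      ring
    simp only [this, ← Finset.mul_sum]
    ring
  rw [h1, Finset.sum_congr rfl h3]
  have hC : ∀ (f : NoisePoly) (c : ℝ), f * MvPolynomial.C c = c • f := by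
    intro f c; rw [MvPolynomial.smul_eq_C_mul, mul_comm]
  simp only [mul_sub, hC, map_sub, map_smul, smul_eq_mul, mul_smul_comm, Finset.mul_sum, map_sum,
    Finset.sum_add_distrib, Finset.sum_sub_distrib, mul_add]
  have h4 : ∑ k ∈ i.others, ∑ β, (√(i.n : ℝ))⁻¹ * ((√(i.n : ℝ))⁻¹ *
      E (Φ' β * H * (x k i.a α * x k i.a β))) =
      ∑ β, ∑ k ∈ i.others, (i.n : ℝ)⁻¹ * E (Φ' β * H * (x k i.a α * x k i.a β)) := by
    rw [Finset.sum_comm]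
    refine Finset.sum_congr rfl fun β _ => Finset.sum_congr rfl fun k _ => ?_
    rw [← mul_assoc, ← mul_inv, Real.mul_self_sqrt hn]
  rw [h4, Finset.sum_comm (s := i.others) (t := Finset.univ)]
  ring

/-- Concentration of the averages gives the approximate Stein identity at the next step. -/
theorem AvgConcentrates.approxStein (hE : IsNoiseExpectation mom E)
    {F : ℕ → Fin d → MvPolynomial (Fin d) ℝ} {t : ℕ}
    {L : MvPolynomial (Fin d ⊕ Unit) ℝ →ₗ[ℝ] ℝ} (h : AvgConcentrates E F t L) :
    ApproxStein E F (t + 1) (fun α => L (sigTest * liftTest (F t α)))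
      (Matrix.of fun α β => L (liftTest (F t α * F t β))) := by
  intro φ φ' α
  simp only [testPoly_mul (t := t + 1), testPoly_X_inl, testPoly_sigTest, Matrix.of_apply]
  simp only [expect_msgPoly_mul hE F t φ φ' α]
  have bT : ∀ φ, MomentBdd E {x | ∃ n a b, 1 ≤ n ∧ x = testPoly F (t + 1) φ n a b} := fun φ =>
    (weightBdd_testPoly hE F (t + 1) φ).momentBdd_range
  have bN : MomentBdd E {x | ∃ n a b, 1 ≤ n ∧ x = nonlinPoly F t n a b α} :=
    (weightBdd_nonlinPoly hE F t α).momentBdd_range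
  have hmem : ∀ (i : PairIdx) φ, testPoly F (t + 1) φ i.n i.a i.b ∈
      {x | ∃ n a b, 1 ≤ n ∧ x = testPoly F (t + 1) φ n a b} := fun i φ => ⟨_, _, _, i.one_le, rfl⟩
  have hmem' : ∀ (i : PairIdx) φ, testPoly F (t + 1) φ i.n i.a' i.b' ∈
      {x | ∃ n a b, 1 ≤ n ∧ x = testPoly F (t + 1) φ n a b} := fun i φ => ⟨_, _, _, i.one_le, rfl⟩
  have hmemN : ∀ (i : PairIdx) k, nonlinPoly F t i.n k i.a α ∈
      {x | ∃ n a b, 1 ≤ n ∧ x = nonlinPoly F t n a b α} := fun i k => ⟨_, _, _, i.one_le, rfl⟩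
  -- Here and in `t2`, a bounded factor multiplies a centred empirical average, which vanishes in
  -- `L²`.
  have t1 := hE.tendsto_expect_mul (u := fun i => sigVar i.a * testPoly F (t + 1) φ i.n i.a i.b *
      testPoly F (t + 1) φ' i.n i.a' i.b') (((hE.momentBdd_sigVar.mul hE (bT φ)).mul hE
      (bT φ')).mono (by
        rintro _ ⟨i, rfl⟩
        exact Set.mul_mem_mul (Set.mul_mem_mul ⟨i.a, rfl⟩ (hmem i φ)) (hmem' i φ')))
      (h (sigTest * liftTest (F t α)))
  have t2 := fun β => hE.tendsto_expect_mul
      (u := fun i => testPoly F (t + 1) (MvPolynomial.pderiv (Sum.inl β) φ) i.n i.a i.b *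
      testPoly F (t + 1) φ' i.n i.a' i.b') (((bT _).mul hE (bT φ')).mono (by
        rintro _ ⟨i, rfl⟩
        exact Set.mul_mem_mul (hmem i _) (hmem' i φ')))
      (h (liftTest (F t α * F t β)))
  -- Where every term is of order `1 / n`, the weaker bound asked at the exceptional vertex follows
  -- from the strong one.
  have hsm : ∀ (i : PairIdx) (u v : NoisePoly),
      √(i.n : ℝ) • (u * v) = (√(i.n : ℝ))⁻¹ • (((i.n : ℝ) • u) * v) := by
    intro i u v
    have h1 := one_le_sqrt_natCast i.one_le
    rw [smul_mul_assoc, smul_smul]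
    congr 1
    nth_rw 3 [← Real.mul_self_sqrt (Nat.cast_nonneg i.n)]
    field_simp
  have hle : ∀ i : PairIdx, |(√(i.n : ℝ))⁻¹| ≤ 1 := by
    intro i
    rw [abs_of_nonneg (by positivity)]
    exact inv_le_one_of_one_le₀ (one_le_sqrt_natCast i.one_le)
  -- The message `k → a` leaves out its target `a`, so `s(a, k)` does not enter it directly.
  have t3 : Tendsto (fun i : PairIdx => (√(i.n : ℝ))⁻¹ * ∑ k ∈ i.others,
      E (edgeDeriv s(i.a, k) (nonlinPoly F t i.n k i.a α) *
      (testPoly F (t + 1) φ i.n i.a i.b * testPoly F (t + 1) φ' i.n i.a' i.b')))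
      PairIdx.large (𝓝 0) := by
    have hb := (weightBdd_nonlinPoly hE F t α).momentBdd_edgeDeriv_of_not_proper.mul hE
      ((bT φ).mul hE (bT φ'))
    refine hE.tendsto_sum_of_momentBdd _ (hb.mono ?_) ((hb.smul hE 1).mono ?_)
    · rintro _ ⟨i, k, -, -, rfl⟩
      rw [← smul_mul_assoc]
      exact Set.mul_mem_mul ⟨i.n, k, i.a, s(i.a, k), i.one_le, fun _ => Sym2.eq_swap, rfl⟩
        (Set.mul_mem_mul (hmem i φ) (hmem' i φ'))
    · rintro _ ⟨i, k, -, rfl⟩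
      rw [hsm]
      exact ⟨_, _, (Set.mul_mem_mul ⟨i.n, k, i.a, s(i.a, k), i.one_le, fun _ => Sym2.eq_swap, rfl⟩
        (Set.mul_mem_mul (hmem i φ) (hmem' i φ'))), hle i, rfl⟩
  -- Since `a ≠ a'`, the edge `s(a, k)` meets the source `a'` of the second message only when `k =
  -- a'`.
  have t4 : Tendsto (fun i : PairIdx => (√(i.n : ℝ))⁻¹ * ∑ k ∈ i.others,
      E (edgeDeriv s(i.a, k) (testPoly F (t + 1) φ' i.n i.a' i.b') *
      (nonlinPoly F t i.n k i.a α * testPoly F (t + 1) φ i.n i.a i.b)))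
      PairIdx.large (𝓝 0) := by
    have hb := bN.mul hE (bT φ)
    refine hE.tendsto_sum_of_momentBdd _
      (((weightBdd_testPoly hE F (t + 1) φ').momentBdd_edgeDeriv_of_not_proper.mul hE hb).mono ?_)
      (((weightBdd_testPoly hE F (t + 1) φ').momentBdd_edgeDeriv.mul hE hb).mono ?_)
    · rintro _ ⟨i, k, hk, hk', rfl⟩
      rw [← smul_mul_assoc]
      refine Set.mul_mem_mul ⟨i.n, i.a', i.b', s(i.a, k), i.one_le, ?_, rfl⟩
        (Set.mul_mem_mul (hmemN i k) (hmem i φ))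
      intro h1
      rcases Sym2.mem_iff.1 h1 with h1 | h1
      · exact absurd h1.symm i.haa'
      · exact absurd h1.symm hk'
    · rintro _ ⟨i, k, hk, rfl⟩
      rw [← smul_mul_assoc]
      exact Set.mul_mem_mul ⟨i.n, i.a', i.b', s(i.a, k), i.one_le, rfl⟩
        (Set.mul_mem_mul (hmemN i k) (hmem i φ))
  have t5 : ∀ β, Tendsto (fun i : PairIdx => (√(i.n : ℝ))⁻¹ * ∑ k ∈ i.others,
      E (indirectDeriv F t i.n i.a i.b k β * (nonlinPoly F t i.n k i.a α *
        testPoly F (t + 1) (MvPolynomial.pderiv (Sum.inl β) φ) i.n i.a i.b *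
        testPoly F (t + 1) φ' i.n i.a' i.b'))) PairIdx.large (𝓝 0) := by
    intro β
    have hb := (momentBdd_indirectDeriv hE F t β).mul hE
      ((bN.mul hE (bT (MvPolynomial.pderiv (Sum.inl β) φ))).mul hE (bT φ'))
    refine hE.tendsto_sum_of_momentBdd _ (hb.mono ?_) ((hb.smul hE 1).mono ?_)
    · rintro _ ⟨i, k, -, -, rfl⟩
      rw [← smul_mul_assoc]
      exact Set.mul_mem_mul ⟨i.n, i.a, i.b, k, i.one_le, rfl⟩
        (Set.mul_mem_mul (Set.mul_mem_mul (hmemN i k) (hmem i _)) (hmem' i φ'))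
    · rintro _ ⟨i, k, -, rfl⟩
      rw [hsm]
      exact ⟨_, _, (Set.mul_mem_mul ⟨i.n, i.a, i.b, k, i.one_le, rfl⟩
        (Set.mul_mem_mul (Set.mul_mem_mul (hmemN i k) (hmem i _)) (hmem' i φ'))), hle i, rfl⟩
  have := (((t1.add (tendsto_finsetSum Finset.univ fun β _ => t2 β)).add t3).add t4).add
    (tendsto_finsetSum Finset.univ fun β _ => t5 β)
  simpa only [Finset.sum_const_zero, add_zero] using this

end Stein
end

/-! ### From the Stein identity to limits of pairs, and back to concentration. -/

noncomputable section

open scoped Pointwise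

section PairLimit

variable {mom : ℕ → ℝ} {E : NoisePoly →ₗ[ℝ] ℝ} {d : ℕ}
  {F : ℕ → Fin d → MvPolynomial (Fin d) ℝ} {t : ℕ}
  {L : MvPolynomial (Fin d ⊕ Unit) ℝ →ₗ[ℝ] ℝ}
  {μ : Fin d → ℝ} {S : Matrix (Fin d) (Fin d) ℝ}

/-- Messages from distinct sources are asymptotically independent with limit law `L`. -/
def PairLimit (E : NoisePoly →ₗ[ℝ] ℝ) (F : ℕ → Fin d → MvPolynomial (Fin d) ℝ) (t : ℕ)
    (L : MvPolynomial (Fin d ⊕ Unit) ℝ →ₗ[ℝ] ℝ) : Prop :=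
  ∀ φ φ', Tendsto (fun i : PairIdx => E (testPoly F t φ i.n i.a i.b *
    testPoly F t φ' i.n i.a' i.b')) PairIdx.large (𝓝 (L φ * L φ'))

/-- The law of `(μ Θ + G, Θ)` on polynomials: moments of `Θ` and Stein's identity for `G`. -/
structure IsLimitLaw (mom : ℕ → ℝ) (μ : Fin d → ℝ) (S : Matrix (Fin d) (Fin d) ℝ)
    (L : MvPolynomial (Fin d ⊕ Unit) ℝ →ₗ[ℝ] ℝ) : Prop where
  one : L 1 = 1
  sig_pow : ∀ k, L (sigTest ^ k) = mom k
  stein : ∀ φ α, L (MvPolynomial.X (Sum.inl α) * φ) =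
    μ α * L (sigTest * φ) + ∑ β, S α β * L (MvPolynomial.pderiv (Sum.inl β) φ)

/-- Second moment method: after centring, the pairs `k ≠ k'` have vanishing correlation uniformly in
the indices, while the diagonal pairs contribute `O(1 / n)` to the mean square. -/
lemma PairLimit.avgConcentrates (hE : IsNoiseExpectation mom E) (h : PairLimit E F t L)
    (hL : L 1 = 1) : AvgConcentrates E F t L := by
  intro ψ
  set c := L ψ with hc
  set ψ' := ψ - MvPolynomial.C c with hψ'
  have hLψ' : L ψ' = 0 := by
    rw [hψ', map_sub, ← mul_one (MvPolynomial.C c), ← MvPolynomial.smul_eq_C_mul, map_smul, hL]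
    simp [hc]
  have htp : ∀ n k a, testPoly F t ψ n k a = testPoly F t ψ' n k a + MvPolynomial.C c := by
    intro n k a
    simp [hψ', testPoly]
  have hn : ∀ i : PairIdx, (0 : ℝ) < i.n := fun i => by exact_mod_cast i.one_le
  -- There are `n - 2` terms but the normalisation is `n`, so centring leaves `-2c / n`.
  have hdec : ∀ i : PairIdx, (i.n : ℝ)⁻¹ • ∑ k ∈ i.others, testPoly F t ψ i.n k i.a -
      MvPolynomial.C c = (i.n : ℝ)⁻¹ • ∑ k ∈ i.others, testPoly F t ψ' i.n k i.a +
        (-(2 * c * (i.n : ℝ)⁻¹)) • (1 : NoisePoly) := by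
    intro i
    simp only [htp, Finset.sum_add_distrib, smul_add, Finset.sum_const, add_sub_assoc]
    congr 1
    rw [← Nat.cast_smul_eq_nsmul ℝ, i.card_others]
    simp only [MvPolynomial.smul_eq_C_mul, mul_one, ← map_mul, ← map_sub]
    congr 1
    have := (hn i).ne'
    field_simp
    ring
  have hsq : ∀ i : PairIdx, E (((i.n : ℝ)⁻¹ • ∑ k ∈ i.others, testPoly F t ψ i.n k i.a -
      MvPolynomial.C c) ^ 2) ≤ 2 * E (((i.n : ℝ)⁻¹ • ∑ k ∈ i.others, testPoly F t ψ' i.n k i.a) ^ 2)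
        + 2 * (2 * c * (i.n : ℝ)⁻¹) ^ 2 := by
    intro i
    rw [hdec]
    generalize (i.n : ℝ)⁻¹ • ∑ k ∈ i.others, testPoly F t ψ' i.n k i.a = u
    have := hE.mono (f := (u + (-(2 * c * (i.n : ℝ)⁻¹)) • (1 : NoisePoly)) ^ 2)
      (g := (2 : ℝ) • u ^ 2 + (2 * (2 * c * (i.n : ℝ)⁻¹) ^ 2) • (1 : NoisePoly)) (by
        intro ω
        simp only [map_pow, map_add, MvPolynomial.smul_eval, map_one]
        nlinarith [sq_nonneg (MvPolynomial.eval ω u + 2 * c * (i.n : ℝ)⁻¹)])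
    simpa only [map_add, map_smul, smul_eq_mul, hE.one, mul_one] using this
  have hinv : Tendsto (fun i : PairIdx => (i.n : ℝ)⁻¹) PairIdx.large (𝓝 0) :=
    PairIdx.tendsto_n.inv_tendsto_atTop
  have h2 : Tendsto (fun i : PairIdx => 2 * (2 * c * (i.n : ℝ)⁻¹) ^ 2) PairIdx.large (𝓝 0) := by
    have := ((hinv.const_mul (2 * c)).pow 2).const_mul 2
    simpa using this
  suffices h1 : Tendsto (fun i : PairIdx =>
      E (((i.n : ℝ)⁻¹ • ∑ k ∈ i.others, testPoly F t ψ' i.n k i.a) ^ 2)) PairIdx.large (𝓝 0) by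
    refine squeeze_zero (fun i => ?_) hsq (by simpa using (h1.const_mul 2).add h2)
    simpa using hE.even_nonneg _ 1
  obtain ⟨C, hC0, hC⟩ := (((weightBdd_testPoly hE F t ψ').momentBdd_range).mul hE
    ((weightBdd_testPoly hE F t ψ').momentBdd_range)).abs_expect_le hE
  rw [Metric.tendsto_nhds]
  intro ε hε
  have hp := h ψ' ψ'
  rw [hLψ', zero_mul, Metric.tendsto_nhds] at hp
  -- Eventually along `large` means for all index pairs of a given large dimension, so one threshold
  -- serves all pairs `k ≠ k'` of the double sum.
  have h3 := Filter.eventually_comap.1 (hp (ε / 2) (by positivity))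
  have h4 := (hinv.const_mul C).eventually (gt_mem_nhds (show C * 0 < ε / 2 by simp; positivity))
  filter_upwards [tendsto_comap.eventually h3, h4] with i hi hi'
  rw [Real.dist_eq, sub_zero, abs_of_nonneg (by simpa using hE.even_nonneg _ 1)]
  have hterm : ∀ k ∈ i.others, ∀ k' ∈ i.others,
      E (testPoly F t ψ' i.n k i.a * testPoly F t ψ' i.n k' i.a) ≤
        ε / 2 + if k = k' then C else 0 := by
    intro k hk k' hk'
    obtain ⟨hk1, hk2, -⟩ := PairIdx.mem_others.1 hk
    obtain ⟨hk1', hk2', -⟩ := PairIdx.mem_others.1 hk'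
    split_ifs with hkk
    · have := (le_abs_self _).trans (hC _ (Set.mul_mem_mul ⟨i.n, k, i.a, i.one_le, rfl⟩
        ⟨i.n, k', i.a, i.one_le, rfl⟩))
      linarith
    · have := hi ⟨i.n, k, i.a, k', i.a, hk1, i.ha, hk1', i.ha, hk2, hk2', hkk⟩ rfl
      rw [Real.dist_eq, sub_zero] at this
      linarith [le_abs_self (E (testPoly F t ψ' i.n k i.a * testPoly F t ψ' i.n k' i.a))]
  have hle : (i.others.card : ℝ) ≤ i.n := by exact_mod_cast i.card_others_le
  have hsum : E ((∑ k ∈ i.others, testPoly F t ψ' i.n k i.a) ^ 2) ≤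
      i.n * (i.n * (ε / 2) + C) := by
    rw [sq, Finset.sum_mul_sum, map_sum]
    have h5 : ∀ k ∈ i.others, E (∑ k' ∈ i.others,
        testPoly F t ψ' i.n k i.a * testPoly F t ψ' i.n k' i.a) ≤ i.n * (ε / 2) + C := by
      intro k hk
      rw [map_sum]
      refine (Finset.sum_le_sum (hterm k hk)).trans ?_
      rw [Finset.sum_add_distrib, Finset.sum_ite_eq, if_pos hk, Finset.sum_const, nsmul_eq_mul]
      gcongr
    refine (Finset.sum_le_card_nsmul _ _ _ h5).trans ?_
    rw [nsmul_eq_mul]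
    gcongr
  rw [smul_pow, map_smul, smul_eq_mul]
  have hni := hn i
  calc ((i.n : ℝ)⁻¹) ^ 2 * E ((∑ k ∈ i.others, testPoly F t ψ' i.n k i.a) ^ 2)
      ≤ ((i.n : ℝ)⁻¹) ^ 2 * (i.n * (i.n * (ε / 2) + C)) := by gcongr
    _ = ε / 2 + C * (i.n : ℝ)⁻¹ := by field_simp
    _ < ε := by linarith

/-- A polynomial in the signal, as a test polynomial. -/
def sigPoly (q : Polynomial ℝ) : MvPolynomial (Fin d ⊕ Unit) ℝ := Polynomial.aeval sigTest q

lemma testPoly_sigPoly (q : Polynomial ℝ) (n a b : ℕ) :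
    testPoly F t (sigPoly q) n a b = Polynomial.aeval (sigVar a) q := by
  rw [← testPoly_sigTest F t n a b, testPoly, sigPoly, ← Polynomial.aeval_algHom_apply]
  rfl

lemma IsLimitLaw.expect_signal (hE : IsNoiseExpectation mom E) (hL : IsLimitLaw mom μ S L)
    {a a' : ℕ} (h : a ≠ a') (q q' : Polynomial ℝ) :
    E (Polynomial.aeval (sigVar a) q * Polynomial.aeval (sigVar a') q') =
      L (sigPoly q) * L (sigPoly q') := by
  have hmon : ∀ (A : Type) [CommRing A] [Algebra ℝ A] (x : A) (k : ℕ) (c : ℝ),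
      Polynomial.aeval x (Polynomial.monomial k c) = c • x ^ k := by
    intro A _ _ x k c
    rw [Polynomial.aeval_monomial, Algebra.smul_def]
  induction q using Polynomial.induction_on' with
  | add p q hp hq => simp only [map_add, add_mul, hp, hq, sigPoly]
  | monomial k c =>
    induction q' using Polynomial.induction_on' with
    | add p q hp hq =>
      simp only [map_add, mul_add, hp, hq, sigPoly]
    | monomial l c' =>
      simp only [sigPoly, hmon, smul_mul_smul_comm, map_smul, hE.indep a a' h, hL.sig_pow,
        smul_eq_mul]
      ring

/-- A test polynomial that can be replaced by a polynomial in the signal. -/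
def SigReducible (E : NoisePoly →ₗ[ℝ] ℝ) (F : ℕ → Fin d → MvPolynomial (Fin d) ℝ) (t : ℕ)
    (L : MvPolynomial (Fin d ⊕ Unit) ℝ →ₗ[ℝ] ℝ) (φ : MvPolynomial (Fin d ⊕ Unit) ℝ) : Prop :=
  ∃ q : Polynomial ℝ, L φ = L (sigPoly q) ∧ ∀ φ', Tendsto (fun i : PairIdx =>
    E (testPoly F t φ i.n i.a i.b * testPoly F t φ' i.n i.a' i.b') -
    E (testPoly F t (sigPoly q) i.n i.a i.b * testPoly F t φ' i.n i.a' i.b'))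
      PairIdx.large (𝓝 0)

namespace SigReducible

lemma sigPoly (q : Polynomial ℝ) : SigReducible E F t L (sigPoly q) :=
  ⟨q, rfl, fun φ' => by simp [tendsto_const_nhds]⟩

lemma add {φ ψ : MvPolynomial (Fin d ⊕ Unit) ℝ} (hφ : SigReducible E F t L φ)
    (hψ : SigReducible E F t L ψ) : SigReducible E F t L (φ + ψ) := by
  obtain ⟨q, hq, h⟩ := hφ
  obtain ⟨q', hq', h'⟩ := hψ
  refine ⟨q + q', by simp only [_root_.sigPoly, map_add, hq, hq'], fun φ' => ?_⟩
  have := (h φ').add (h' φ')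
  rw [add_zero] at this
  refine this.congr fun i => ?_
  simp only [testPoly, _root_.sigPoly, map_add, add_mul]
  ring

lemma smul {φ : MvPolynomial (Fin d ⊕ Unit) ℝ} (c : ℝ) (hφ : SigReducible E F t L φ) :
    SigReducible E F t L (c • φ) := by
  obtain ⟨q, hq, h⟩ := hφ
  refine ⟨c • q, by simp only [_root_.sigPoly, map_smul, hq], fun φ' => ?_⟩
  have := (h φ').const_mul c
  rw [mul_zero] at this
  refine this.congr fun i => ?_
  simp only [testPoly, _root_.sigPoly, map_smul, smul_mul_assoc, smul_eq_mul]
  ring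

lemma sum {ι : Type} (s : Finset ι) {φ : ι → MvPolynomial (Fin d ⊕ Unit) ℝ}
    (h : ∀ i, SigReducible E F t L (φ i)) : SigReducible E F t L (∑ i ∈ s, φ i) := by
  classical
  induction s using Finset.induction_on with
  | empty =>
    have := sigPoly (E := E) (F := F) (t := t) (L := L) 0
    simpa [_root_.sigPoly] using this
  | insert i s hi ih => rw [Finset.sum_insert hi]; exact (h i).add ih

/-- The same recursion holds exactly for `L` and up to `o(1)` for `E`, so one signal polynomial
serves both. -/
lemma X_mul (hL : IsLimitLaw mom μ S L) (hs : ApproxStein E F t μ S)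
    {φ : MvPolynomial (Fin d ⊕ Unit) ℝ} (α : Fin d)
    (h1 : SigReducible E F t L (sigTest * φ))
    (h2 : ∀ β, SigReducible E F t L (MvPolynomial.pderiv (Sum.inl β) φ)) :
    SigReducible E F t L (MvPolynomial.X (Sum.inl α) * φ) := by
  obtain ⟨q, hq, h⟩ := (h1.smul (μ α)).add (sum Finset.univ fun β => (h2 β).smul (S α β))
  refine ⟨q, ?_, fun φ' => ?_⟩
  · rw [← hq, hL.stein]
    simp only [map_add, map_smul, map_sum, smul_eq_mul]
  · have := (hs φ φ' α).add (h φ')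
    rw [add_zero] at this
    refine this.congr fun i => ?_
    simp only [testPoly, map_add, map_smul, map_sum, add_mul, Finset.sum_mul, smul_mul_assoc,
      smul_eq_mul]
    ring

/-- Induction on the degree in the message variables: Stein's identity trades a message variable for
a signal variable or for a derivative, and neither raises the degree of the remaining monomial in
these variables. -/
lemma monomial (hL : IsLimitLaw mom μ S L) (hs : ApproxStein E F t μ S) (D : ℕ) :
    ∀ (u : (Fin d ⊕ Unit) →₀ ℕ) (c : ℝ), ∑ β, u (Sum.inl β) ≤ D →
      SigReducible E F t L (MvPolynomial.monomial u c) := by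
  induction D with
  | zero =>
    intro u c hu
    have h0 : u = Finsupp.single (Sum.inr ()) (u (Sum.inr ())) := by
      ext i
      rcases i with β | _
      · have := Finset.sum_eq_zero_iff.1 (Nat.le_zero.1 hu) β (Finset.mem_univ β)
        simpa using this
      · simp
    have := sigPoly (E := E) (F := F) (t := t) (L := L)
      (Polynomial.monomial (u (Sum.inr ())) c)
    rw [_root_.sigPoly, Polynomial.aeval_monomial, sigTest] at this
    rw [h0]
    rwa [MvPolynomial.monomial_eq, Finsupp.prod_single_index (by simp)]
  | succ D ih =>
    intro u c hu
    by_cases hpos : ∃ α, u (Sum.inl α) ≠ 0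
    · obtain ⟨α, hα⟩ := hpos
      obtain ⟨v, rfl⟩ : ∃ v, u = Finsupp.single (Sum.inl α) 1 + v := by
        refine ⟨u - Finsupp.single (Sum.inl α) 1, ?_⟩
        rw [add_tsub_cancel_of_le]
        rw [Finsupp.single_le_iff]
        omega
      have hv : ∑ β, v (Sum.inl β) ≤ D := by
        simp only [Finsupp.add_apply, Finset.sum_add_distrib] at hu
        have : ∑ β, (Finsupp.single (Sum.inl α : Fin d ⊕ Unit) 1) (Sum.inl β) = 1 := by
          rw [Finset.sum_eq_single α] <;> simp +contextual [eq_comm]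
        omega
      have hmon : (MvPolynomial.monomial (Finsupp.single (Sum.inl α) 1 + v) c :
          MvPolynomial (Fin d ⊕ Unit) ℝ) =
          MvPolynomial.X (Sum.inl α) * MvPolynomial.monomial v c := by
        rw [MvPolynomial.X, MvPolynomial.monomial_mul, one_mul]
      rw [hmon]
      refine X_mul hL hs α ?_ fun β => ?_
      · rw [sigTest, MvPolynomial.X, MvPolynomial.monomial_mul, one_mul]
        refine ih _ _ ?_
        simpa [Finsupp.single_apply] using hv
      · rw [MvPolynomial.pderiv_monomial]
        refine ih _ _ (le_trans (Finset.sum_le_sum fun γ _ => ?_) hv)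
        simp
    · push Not at hpos
      exact ih u c (by simp [hpos])

end SigReducible

/-- The first message is reduced to a signal polynomial, then the second one by exchanging their
roles. Two polynomials in distinct signals remain, and their expectation factors exactly. -/
theorem ApproxStein.pairLimit (hE : IsNoiseExpectation mom E) (hL : IsLimitLaw mom μ S L)
    (hs : ApproxStein E F t μ S) : PairLimit E F t L := by
  have hred : ∀ φ, SigReducible E F t L φ := by
    intro φ
    induction φ using MvPolynomial.induction_on' with
    | monomial u c => exact SigReducible.monomial hL hs _ u c le_rfl
    | add p q hp hq => exact hp.add hq
  intro φ φ'
  obtain ⟨q, hq, h⟩ := hred φ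
  obtain ⟨q', hq', h'⟩ := hred φ'
  have h1 := h φ'
  have h2 := (h' (sigPoly q)).comp PairIdx.tendsto_swap
  have h3 := (h1.add h2).add_const (L φ * L φ')
  simp only [add_zero, zero_add] at h3
  refine h3.congr fun i => ?_
  have h4 := hL.expect_signal hE i.haa' q q'
  simp only [Function.comp_apply, PairIdx.swap, testPoly_sigPoly]
  rw [hq, hq', ← h4, mul_comm (testPoly F t φ' i.n i.a' i.b'),
    mul_comm (Polynomial.aeval (sigVar i.a') q')]
  ring

/-- The messages start from zero. -/
lemma approxStein_zero : ApproxStein E F 0 0 0 := by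
  intro φ φ' α
  simp [testPoly_mul, testPoly_X_inl, msgPoly, tendsto_const_nhds]

end PairLimit
end

noncomputable section

/-! ### Expectations of polynomials in independent variables -/

/-- Moment recursion of the standard Gaussian. -/
lemma integral_pow_succ_gaussianReal (k : ℕ) :
    ∫ x, x ^ (k + 1) ∂(gaussianReal 0 1) = k * ∫ x, x ^ (k - 1) ∂(gaussianReal 0 1) := by
  have hint : ∀ m : ℕ, Integrable (fun x : ℝ => x ^ m) (gaussianReal 0 1) := fun m => by
    have h := (memLp_id_gaussianReal (μ := 0) (v := 1) m).integrable_norm_pow'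
    refine h.mono' (by fun_prop) (ae_of_all _ fun x => by simp)
  have hint' : ∀ m : ℕ, Integrable (fun x : ℝ => gaussianPDFReal 0 1 x * x ^ m) := fun m => by
    have h := hint m
    rw [gaussianReal_of_var_ne_zero _ one_ne_zero, integrable_withDensity_iff_integrable_smul'
      (measurable_gaussianPDF 0 1) (ae_of_all _ fun x => gaussianPDF_lt_top)] at h
    simpa only [toReal_gaussianPDF, smul_eq_mul] using h
  have hder : ∀ x : ℝ, HasDerivAt (fun x => -gaussianPDFReal 0 1 x) (x * gaussianPDFReal 0 1 x) x := by
    intro x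
    have h1 : HasDerivAt (fun x : ℝ => -(x - 0) ^ 2 / (2 * ((1 : NNReal) : ℝ))) (-x) x := by
      have := (((hasDerivAt_id' x).sub_const 0).fun_pow 2).fun_neg.div_const
        (2 * ((1 : NNReal) : ℝ))
      exact this.congr_deriv (by norm_num; ring)
    have h2 := (h1.exp.const_mul (√(2 * Real.pi * ((1 : NNReal) : ℝ)))⁻¹).fun_neg
    simp only [gaussianPDFReal]
    exact h2.congr_deriv (by ring)
  -- For `k = 0` the truncated exponent `k - 1` is harmless, because its coefficient `k` vanishes.
  have hpow : ∀ x : ℝ, HasDerivAt (fun x : ℝ => x ^ k) (k * x ^ (k - 1)) x := fun x =>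
    hasDerivAt_pow k x
  have h := integral_mul_deriv_eq_deriv_mul_of_integrable (u := fun x : ℝ => x ^ k)
    (v := fun x => -gaussianPDFReal 0 1 x) (fun x _ => hpow x) (fun x _ => hder x)
    ((hint' (k + 1)).congr (ae_of_all _ fun x => by simp only [Pi.mul_apply]; ring))
    (((hint' (k - 1)).const_mul (-(k : ℝ))).congr
      (ae_of_all _ fun x => by simp only [Pi.mul_apply]; ring))
    ((hint' k).neg.congr (ae_of_all _ fun x => by simp only [Pi.mul_apply, Pi.neg_apply]; ring))
  rw [integral_gaussianReal_eq_integral_smul one_ne_zero,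
    integral_gaussianReal_eq_integral_smul one_ne_zero]
  simp only [smul_eq_mul]
  rw [← integral_const_mul, ← neg_inj]
  have e1 : ∫ x, gaussianPDFReal 0 1 x * x ^ (k + 1) =
      ∫ x, x ^ k * (x * gaussianPDFReal 0 1 x) := by congr 1; ext x; ring
  have e2 : ∫ x, (k : ℝ) * (gaussianPDFReal 0 1 x * x ^ (k - 1)) =
      -∫ x, (k * x ^ (k - 1)) * -gaussianPDFReal 0 1 x := by
    rw [← integral_neg]; congr 1; ext x; ring
  rw [e1, e2, h]

section PolyExpect

variable {σ : Type} (ν : σ → Measure ℝ) [∀ v, IsProbabilityMeasure (ν v)]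

/-- All moments are finite. -/
def FiniteMoments (ν : σ → Measure ℝ) : Prop := ∀ v, ∀ k : ℕ, Integrable (fun x : ℝ => x ^ k) (ν v)

variable {ν}

lemma FiniteMoments.memLp_eval (hν : FiniteMoments ν) (f : MvPolynomial σ ℝ) (p : ℕ) :
    MemLp (fun ω => MvPolynomial.eval ω f) p (Measure.infinitePi ν) := by
  have hX : ∀ v, ∀ p : ℕ, MemLp (fun ω : σ → ℝ => ω v) p (Measure.infinitePi ν) := by
    intro v p
    have h1 : MemLp (fun x : ℝ => x) p (ν v) := by
      rcases Nat.eq_zero_or_pos p with rfl | hp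
      · rw [Nat.cast_zero, memLp_zero_iff_aestronglyMeasurable]; fun_prop
      · rw [← integrable_norm_rpow_iff (by fun_prop) (by exact_mod_cast hp.ne') (by simp)]
        simpa using (hν v p).norm
    exact h1.comp_measurePreserving (measurePreserving_eval_infinitePi ν v)
  induction f using MvPolynomial.induction_on generalizing p with
  | C r => simpa using memLp_const r
  | add f g hf hg => simp only [map_add]; exact (hf p).add (hg p)
  | mul_X f v hf =>
    -- Hölder with exponents `2p, 2p`, which is why the induction runs over all `p`.
    have : ENNReal.HolderTriple ((2 * p : ℕ) : ENNReal) ((2 * p : ℕ) : ENNReal) p := by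
      constructor
      push_cast
      rw [ENNReal.mul_inv (by simp) (by simp), ← add_mul, ENNReal.inv_two_add_inv_two, one_mul]
    simpa using (hX v (2 * p)).mul' (hf (2 * p))

lemma FiniteMoments.integrable_eval (hν : FiniteMoments ν) (f : MvPolynomial σ ℝ) :
    Integrable (fun ω => MvPolynomial.eval ω f) (Measure.infinitePi ν) := by
  simpa [memLp_one_iff_integrable] using hν.memLp_eval f 1

/-- Expectation of a polynomial in independent variables. -/
def polyExpect (hν : FiniteMoments ν) : MvPolynomial σ ℝ →ₗ[ℝ] ℝ where
  toFun f := ∫ ω, MvPolynomial.eval ω f ∂(Measure.infinitePi ν)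
  map_add' f g := by
    simp only [map_add]
    exact integral_add (hν.integrable_eval f) (hν.integrable_eval g)
  map_smul' c f := by
    simp only [MvPolynomial.smul_eval, RingHom.id_apply, smul_eq_mul]
    exact integral_const_mul _ _

lemma polyExpect_apply (hν : FiniteMoments ν) (f : MvPolynomial σ ℝ) :
    polyExpect hν f = ∫ ω, MvPolynomial.eval ω f ∂(Measure.infinitePi ν) := rfl

lemma polyExpect_nonneg (hν : FiniteMoments ν) (f : MvPolynomial σ ℝ)
    (h : ∀ ω, 0 ≤ MvPolynomial.eval ω f) : 0 ≤ polyExpect hν f :=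
  integral_nonneg h

lemma polyExpect_monomial (hν : FiniteMoments ν) (m : σ →₀ ℕ) (c : ℝ) :
    polyExpect hν (MvPolynomial.monomial m c) = c * m.prod fun v k => ∫ x, x ^ k ∂(ν v) := by
  rw [polyExpect_apply]
  simp only [MvPolynomial.eval_monomial]
  rw [integral_const_mul]
  congr 1
  have h1 : iIndepFun (fun (v : m.support) (ω : σ → ℝ) => ω v) (Measure.infinitePi ν) :=
    iIndepFun.precomp Subtype.val_injective
      (iIndepFun_infinitePi (P := ν) (X := fun _ x => x) (fun _ => measurable_id))
  have h2 := h1.integral_fun_prod_comp (f := fun (v : m.support) (x : ℝ) => x ^ m v)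
    (fun v => (measurable_pi_apply _).aemeasurable)
    (fun v => (continuous_pow (m v)).aestronglyMeasurable)
  simp only [Finsupp.prod]
  rw [← Finset.prod_coe_sort m.support (fun v => ∫ x, x ^ m v ∂(ν v))]
  simp only [← Finset.prod_coe_sort m.support (fun v => _ ^ m v)]
  rw [h2]
  refine Finset.prod_congr rfl fun v _ => ?_
  rw [← integral_map (φ := fun ω : σ → ℝ => ω v) (f := fun x => x ^ m v)
    (measurable_pi_apply _).aemeasurable (continuous_pow (m v)).aestronglyMeasurable, Measure.infinitePi_map_eval]

lemma polyExpect_one (hν : FiniteMoments ν) : polyExpect hν 1 = 1 := by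
  simp [polyExpect_apply]

/-- Gaussian integration by parts for polynomials. -/
lemma polyExpect_X_mul (hν : FiniteMoments ν) {v : σ} (hv : ν v = gaussianReal 0 1)
    (f : MvPolynomial σ ℝ) :
    polyExpect hν (MvPolynomial.X v * f) = polyExpect hν (MvPolynomial.pderiv v f) := by
  induction f using MvPolynomial.induction_on' with
  | add f g hf hg => simp only [mul_add, map_add, hf, hg]
  | monomial m c =>
    rw [MvPolynomial.X, MvPolynomial.monomial_mul, one_mul, MvPolynomial.pderiv_monomial,
      polyExpect_monomial, polyExpect_monomial,
      ← Finsupp.mul_prod_erase' _ v _ (fun i => by simp),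
      ← Finsupp.mul_prod_erase' (m - _) v _ (fun i => by simp)]
    have e1 : (Finsupp.single v 1 + m).erase v = m.erase v := by
      ext u
      by_cases h : u = v
      · subst h; simp
      · simp [Finsupp.erase_ne h]
    have e2 : (m - Finsupp.single v 1).erase v = m.erase v := by
      ext u
      by_cases h : u = v
      · subst h; simp
      · simp [Finsupp.erase_ne h, h]
    rw [e1, e2]
    simp only [Finsupp.add_apply, Finsupp.single_eq_same, Finsupp.coe_tsub, Pi.sub_apply]
    rw [hv, add_comm 1, integral_pow_succ_gaussianReal]
    ring

lemma polyExpect_X_pow (hν : FiniteMoments ν) (v : σ) (k : ℕ) :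
    polyExpect hν (MvPolynomial.X v ^ k) = ∫ x, x ^ k ∂(ν v) := by
  rw [MvPolynomial.X_pow_eq_monomial, polyExpect_monomial, one_mul,
    Finsupp.prod_single_index (by simp)]

lemma polyExpect_X_pow_mul (hν : FiniteMoments ν) {v w : σ} (h : v ≠ w) (k l : ℕ) :
    polyExpect hν (MvPolynomial.X v ^ k * MvPolynomial.X w ^ l) =
      (∫ x, x ^ k ∂(ν v)) * ∫ x, x ^ l ∂(ν w) := by
  rw [MvPolynomial.X_pow_eq_monomial, MvPolynomial.X_pow_eq_monomial, MvPolynomial.monomial_mul,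
    polyExpect_monomial, one_mul, one_mul, ← Finsupp.mul_prod_erase' _ v _ (fun i => by simp)]
  have e : (Finsupp.single v k + Finsupp.single w l).erase v = Finsupp.single w l := by
    ext u
    by_cases hu : u = v
    · subst hu; simp [h.symm]
    · simp [Finsupp.erase_ne hu]
  rw [e, Finsupp.prod_single_index (by simp)]
  simp [h.symm]

end PolyExpect
end

noncomputable section

open scoped MatrixOrder

/-! ### The limit law -/

lemma MvPolynomial.eval_aeval_apply {σ τ : Type} (ω : σ → ℝ) (m : τ → MvPolynomial σ ℝ)
    (p : MvPolynomial τ ℝ) :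
    MvPolynomial.eval ω (MvPolynomial.aeval m p) =
      MvPolynomial.eval (fun i => MvPolynomial.eval ω (m i)) p := by
  induction p using MvPolynomial.induction_on with
  | C r => simp
  | add p q hp hq => simp only [map_add, hp, hq]
  | mul_X p i hp => simp only [map_mul, hp, MvPolynomial.aeval_X, MvPolynomial.eval_X]

section LimitLaw

variable {π : Measure ℝ} {d : ℕ} {F : ℕ → Fin d → MvPolynomial (Fin d) ℝ}

/-- The laws of the coordinates of a standard Gaussian vector and of an independent signal. -/
def limitCoordLaw (π : Measure ℝ) (d : ℕ) : Fin d ⊕ Unit → Measure ℝ :=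
  Sum.elim (fun _ => gaussianReal 0 1) fun _ => π

lemma integrable_pow_gaussianReal (v : NNReal) (k : ℕ) :
    Integrable (fun x : ℝ => x ^ k) (gaussianReal 0 v) := by
  have h := (memLp_id_gaussianReal (μ := 0) (v := v) k).integrable_norm_pow'
  exact h.mono' (by fun_prop) (ae_of_all _ fun x => by simp)

lemma finiteMoments_limitCoordLaw (hπ : ∀ k : ℕ, Integrable (fun x : ℝ => x ^ k) π) :
    FiniteMoments (limitCoordLaw π d) := by
  rintro (j | _) k
  · exact integrable_pow_gaussianReal 1 k
  · exact hπ k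

lemma continuous_testEval_seVec (t : ℕ) (φ : MvPolynomial (Fin d ⊕ Unit) ℝ) :
    Continuous fun p => testEval φ (seVec π F t p) p.1 := by
  unfold testEval
  refine (MvPolynomial.continuous_eval φ).comp (continuous_pi ?_)
  rintro (α | _)
  · simp only [Sum.elim_inl, seVec]
    fun_prop
  · simp only [Sum.elim_inr]
    fun_prop

/-- The coordinates of `(μ Θ + R g, Θ)` as polynomials. -/
def limitCoord (μ : Fin d → ℝ) (R : Matrix (Fin d) (Fin d) ℝ) :
    Fin d ⊕ Unit → MvPolynomial (Fin d ⊕ Unit) ℝ :=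
  Sum.elim (fun α => μ α • MvPolynomial.X (Sum.inr ()) +
    ∑ j, R α j • MvPolynomial.X (Sum.inl j)) fun _ => MvPolynomial.X (Sum.inr ())

lemma testEval_seVec_eq (t : ℕ) (φ : MvPolynomial (Fin d ⊕ Unit) ℝ) (ω : Fin d ⊕ Unit → ℝ) :
    testEval φ (seVec π F t (ω (Sum.inr ()), Matrix.toEuclideanCLM (𝕜 := ℝ)
      (CFC.sqrt (seCov π F t)) (WithLp.toLp 2 fun j => ω (Sum.inl j)))) (ω (Sum.inr ())) =
    MvPolynomial.eval ω (MvPolynomial.aeval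
      (limitCoord (seMean π F t) (CFC.sqrt (seCov π F t))) φ) := by
  rw [MvPolynomial.eval_aeval_apply, testEval]
  congr 2
  ext v
  rcases v with α | _
  · simp [seVec, limitCoord, Matrix.mulVec, dotProduct, MvPolynomial.smul_eval]
  · simp [limitCoord]

variable [IsProbabilityMeasure π]

instance (v : Fin d ⊕ Unit) : IsProbabilityMeasure (limitCoordLaw π d v) := by
  rcases v with j | _
  · exact inferInstanceAs (IsProbabilityMeasure (gaussianReal 0 1))
  · exact inferInstanceAs (IsProbabilityMeasure π)

/-- The expectation of a test polynomial at `(μ Θ + R g, Θ)`. -/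
def limitExpect (hπ : ∀ k : ℕ, Integrable (fun x : ℝ => x ^ k) π) (μ : Fin d → ℝ)
    (R : Matrix (Fin d) (Fin d) ℝ) : MvPolynomial (Fin d ⊕ Unit) ℝ →ₗ[ℝ] ℝ :=
  (polyExpect (finiteMoments_limitCoordLaw hπ)) ∘ₗ
    (MvPolynomial.aeval (limitCoord μ R)).toLinearMap

lemma limitExpect_apply (hπ : ∀ k : ℕ, Integrable (fun x : ℝ => x ^ k) π) (μ : Fin d → ℝ)
    (R : Matrix (Fin d) (Fin d) ℝ) (φ : MvPolynomial (Fin d ⊕ Unit) ℝ) :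
    limitExpect hπ μ R φ = polyExpect (finiteMoments_limitCoordLaw hπ)
      (MvPolynomial.aeval (limitCoord μ R) φ) := rfl

/-- With `G = R g` and `g` standard, integration by parts in each `g_j` and the chain rule produce
`∑_j R_αj R_βj`, the entries of `R Rᵀ`. -/
lemma isLimitLaw_limitExpect (hπ : ∀ k : ℕ, Integrable (fun x : ℝ => x ^ k) π) (μ : Fin d → ℝ)
    (R : Matrix (Fin d) (Fin d) ℝ) :
    IsLimitLaw (fun k => ∫ x, x ^ k ∂π) μ (R * R.transpose) (limitExpect hπ μ R) where
  one := by rw [limitExpect_apply, map_one, polyExpect_one]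
  sig_pow k := by
    rw [limitExpect_apply, map_pow, sigTest, MvPolynomial.aeval_X]
    exact polyExpect_X_pow _ (Sum.inr ()) k
  stein φ α := by
    have hder : ∀ j, MvPolynomial.pderiv (Sum.inl j) (MvPolynomial.aeval (limitCoord μ R) φ) =
        ∑ β, R β j • MvPolynomial.aeval (limitCoord μ R) (MvPolynomial.pderiv (Sum.inl β) φ) := by
      intro j
      rw [Derivation.map_mvPolynomial_aeval, Fintype.sum_sum_type]
      have h1 : ∀ β, MvPolynomial.pderiv (Sum.inl j) (limitCoord μ R (Sum.inl β)) =
          MvPolynomial.C (R β j) := by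
        intro β
        simp only [limitCoord, Sum.elim_inl, map_add, Derivation.map_smul, map_sum,
          MvPolynomial.pderiv_X, Pi.single_apply]
        rw [Finset.sum_eq_single j]
        · simp [MvPolynomial.smul_eq_C_mul]
        · intro k _ hk; simp [hk]
        · simp
      have h2 : MvPolynomial.pderiv (Sum.inl j) (limitCoord μ R (Sum.inr ())) = 0 :=
        MvPolynomial.pderiv_X_of_ne (by simp)
      simp [h1, h2, MvPolynomial.smul_eq_C_mul, mul_comm]
    have hX : MvPolynomial.aeval (limitCoord μ R) (MvPolynomial.X (Sum.inl α) * φ) =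
        μ α • MvPolynomial.aeval (limitCoord μ R) (sigTest * φ) +
        ∑ j, R α j • (MvPolynomial.X (Sum.inl j) * MvPolynomial.aeval (limitCoord μ R) φ) := by
      simp only [map_mul, sigTest, MvPolynomial.aeval_X, limitCoord, Sum.elim_inl, Sum.elim_inr,
        add_mul, Finset.sum_mul, smul_mul_assoc]
    simp only [limitExpect_apply]
    rw [hX]
    simp only [map_add, map_smul, map_sum, smul_eq_mul]
    congr 1
    have h3 : ∀ j, polyExpect (finiteMoments_limitCoordLaw hπ)
        (MvPolynomial.X (Sum.inl j) * MvPolynomial.aeval (limitCoord μ R) φ) =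
        ∑ β, R β j * polyExpect (finiteMoments_limitCoordLaw hπ)
          (MvPolynomial.aeval (limitCoord μ R) (MvPolynomial.pderiv (Sum.inl β) φ)) := by
      intro j
      rw [polyExpect_X_mul _ (v := Sum.inl j) rfl, hder]
      simp only [map_sum, map_smul, smul_eq_mul]
    simp only [h3, Finset.mul_sum, Matrix.mul_apply, Matrix.transpose_apply, Finset.sum_mul]
    rw [Finset.sum_comm]
    exact Finset.sum_congr rfl fun β _ => Finset.sum_congr rfl fun j _ => by ring

/-- A product of a law with a centred Gaussian law, as an image of independent coordinates. -/
lemma prod_multivariateGaussian_eq_map (S : Matrix (Fin d) (Fin d) ℝ) :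
    π.prod (multivariateGaussian 0 S) = (Measure.infinitePi (limitCoordLaw π d)).map
      (fun ω => (ω (Sum.inr ()), Matrix.toEuclideanCLM (𝕜 := ℝ) (CFC.sqrt S)
        (WithLp.toLp 2 fun j => ω (Sum.inl j)))) := by
  have h1 : multivariateGaussian 0 S = (Measure.pi fun _ : Fin d => gaussianReal 0 1).map
      (fun g => Matrix.toEuclideanCLM (𝕜 := ℝ) (CFC.sqrt S) (WithLp.toLp 2 g)) := by
    rw [multivariateGaussian, ← map_pi_eq_stdGaussian, Measure.map_map (by fun_prop) (by fun_prop)]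
    congr 1
    ext g
    simp
  have h2 := measurePreserving_sumPiEquivProdPi (limitCoordLaw π d)
  have h3 : MeasurePreserving (Prod.swap : (Fin d → ℝ) × (Unit → ℝ) → _)
      ((Measure.pi fun j : Fin d => limitCoordLaw π d (Sum.inl j)).prod
        (Measure.pi fun j : Unit => limitCoordLaw π d (Sum.inr j))) _ :=
    Measure.measurePreserving_swap
  have h4 : MeasurePreserving (fun ω : Unit → ℝ => ω ())
      (Measure.pi fun j : Unit => limitCoordLaw π d (Sum.inr j)) π :=
    measurePreserving_eval (fun j : Unit => limitCoordLaw π d (Sum.inr j)) ()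
  have h5 : MeasurePreserving
      (fun g : Fin d → ℝ => Matrix.toEuclideanCLM (𝕜 := ℝ) (CFC.sqrt S) (WithLp.toLp 2 g))
      (Measure.pi fun j : Fin d => limitCoordLaw π d (Sum.inl j)) (multivariateGaussian 0 S) :=
    ⟨by fun_prop, h1.symm⟩
  have h6 := ((h4.prod h5).comp h3).comp h2
  rw [Measure.infinitePi_eq_pi, ← h6.map_eq]
  rfl

/-- The expectation functional of state evolution. -/
def seExpect (hπ : ∀ k : ℕ, Integrable (fun x : ℝ => x ^ k) π)
    (F : ℕ → Fin d → MvPolynomial (Fin d) ℝ) (t : ℕ) : MvPolynomial (Fin d ⊕ Unit) ℝ →ₗ[ℝ] ℝ :=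
  limitExpect hπ (seMean π F t) (CFC.sqrt (seCov π F t))

lemma integrable_testEval_seVec (hπ : ∀ k : ℕ, Integrable (fun x : ℝ => x ^ k) π) (t : ℕ)
    (φ : MvPolynomial (Fin d ⊕ Unit) ℝ) :
    Integrable (fun p => testEval φ (seVec π F t p) p.1) (seLaw π F t) := by
  rw [seLaw, prod_multivariateGaussian_eq_map, integrable_map_measure
    (continuous_testEval_seVec t φ).aestronglyMeasurable (by fun_prop)]
  refine ((finiteMoments_limitCoordLaw hπ).integrable_eval (MvPolynomial.aeval
    (limitCoord (seMean π F t) (CFC.sqrt (seCov π F t))) φ)).congr (ae_of_all _ fun ω => ?_)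
  exact (testEval_seVec_eq t φ ω).symm

lemma integral_testEval_seVec (hπ : ∀ k : ℕ, Integrable (fun x : ℝ => x ^ k) π) (t : ℕ)
    (φ : MvPolynomial (Fin d ⊕ Unit) ℝ) :
    ∫ p, testEval φ (seVec π F t p) p.1 ∂(seLaw π F t) = seExpect hπ F t φ := by
  rw [seLaw, prod_multivariateGaussian_eq_map, integral_map (by fun_prop)
    (continuous_testEval_seVec t φ).aestronglyMeasurable, seExpect, limitExpect_apply,
    polyExpect_apply]
  simp only [testEval_seVec_eq]

lemma testEval_liftTest (p : MvPolynomial (Fin d) ℝ) (x : Fin d → ℝ) (θ : ℝ) :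
    testEval (liftTest p) x θ = MvPolynomial.eval x p := by
  rw [testEval, liftTest, MvPolynomial.eval_rename]
  rfl

lemma testEval_mul (φ ψ : MvPolynomial (Fin d ⊕ Unit) ℝ) (x : Fin d → ℝ) (θ : ℝ) :
    testEval (φ * ψ) x θ = testEval φ x θ * testEval ψ x θ := map_mul _ _ _

lemma testEval_sigTest (x : Fin d → ℝ) (θ : ℝ) : testEval sigTest x θ = θ := by
  simp [testEval, sigTest]

lemma seMean_succ (hπ : ∀ k : ℕ, Integrable (fun x : ℝ => x ^ k) π) (t : ℕ) :
    seMean π F (t + 1) = fun α => seExpect hπ F t (sigTest * liftTest (F t α)) := by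
  ext α
  rw [← integral_testEval_seVec hπ]
  simp only [testEval_mul, testEval_sigTest, testEval_liftTest]
  rfl

lemma seCov_succ (hπ : ∀ k : ℕ, Integrable (fun x : ℝ => x ^ k) π) (t : ℕ) :
    seCov π F (t + 1) =
      Matrix.of fun α β => seExpect hπ F t (liftTest (F t α * F t β)) := by
  ext α β
  rw [Matrix.of_apply, ← integral_testEval_seVec hπ]
  simp only [testEval_liftTest, map_mul]
  rfl

/-- The quadratic form at `x` is the expectation of the square of `∑_α x_α F_α`. -/
lemma posSemidef_seCov (hπ : ∀ k : ℕ, Integrable (fun x : ℝ => x ^ k) π) (t : ℕ) :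
    (seCov π F t).PosSemidef := by
  cases t with
  | zero => exact Matrix.PosSemidef.zero
  | succ t =>
    rw [seCov_succ hπ]
    refine Matrix.PosSemidef.of_dotProduct_mulVec_nonneg ?_ fun x => ?_
    · ext α β
      simp [mul_comm (F t α)]
    · have h : star x ⬝ᵥ (Matrix.of fun α β => seExpect hπ F t (liftTest (F t α * F t β))).mulVec x =
          seExpect hπ F t ((∑ α, x α • liftTest (F t α)) * ∑ β, x β • liftTest (F t β)) := by
        rw [Finset.sum_mul_sum]
        simp only [map_sum, smul_mul_smul_comm, map_smul, smul_eq_mul]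
        simp only [dotProduct, Matrix.mulVec, Matrix.of_apply, Finset.mul_sum, liftTest, map_mul]
        refine Finset.sum_congr rfl fun α _ => Finset.sum_congr rfl fun β _ => ?_
        simp only [Pi.star_apply, star_trivial]
        ring
      rw [h, seExpect, limitExpect_apply, map_mul]
      exact polyExpect_nonneg _ _ fun ω => by rw [map_mul]; exact mul_self_nonneg _

/-- Positive semidefiniteness enters here: it makes the square of `CFC.sqrt (seCov π F t)` equal to
the covariance itself. -/
lemma isLimitLaw_seExpect (hπ : ∀ k : ℕ, Integrable (fun x : ℝ => x ^ k) π) (t : ℕ) :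
    IsLimitLaw (fun k => ∫ x, x ^ k ∂π) (seMean π F t) (seCov π F t) (seExpect hπ F t) := by
  have h := isLimitLaw_limitExpect hπ (seMean π F t) (CFC.sqrt (seCov π F t))
  have h1 : (CFC.sqrt (seCov π F t)).transpose = CFC.sqrt (seCov π F t) := by
    have := (CFC.sqrt_nonneg (seCov π F t)).isSelfAdjoint
    rwa [IsSelfAdjoint, Matrix.star_eq_conjTranspose,
      Matrix.conjTranspose_eq_transpose_of_trivial] at this
  rw [h1, CFC.sqrt_mul_sqrt_self _ (posSemidef_seCov hπ t).nonneg] at h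
  exact h

/-- The messages have the limit law predicted by state evolution. -/
theorem pairLimit_seExpect {E : NoisePoly →ₗ[ℝ] ℝ}
    (hE : IsNoiseExpectation (fun k => ∫ x, x ^ k ∂π) E)
    (hπ : ∀ k : ℕ, Integrable (fun x : ℝ => x ^ k) π) (t : ℕ) :
    PairLimit E F t (seExpect hπ F t) := by
  induction t with
  | zero => exact approxStein_zero.pairLimit hE (isLimitLaw_seExpect hπ 0)
  | succ t ih =>
    have h := (ih.avgConcentrates hE (isLimitLaw_seExpect hπ t).one).approxStein hE
    rw [← seMean_succ, ← seCov_succ] at h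
    exact h.pairLimit hE (isLimitLaw_seExpect hπ (t + 1))

end LimitLaw
end

noncomputable section

open scoped Pointwise

/-! ### The finite-dimensional model -/

section Model

variable {d : ℕ} {F : ℕ → Fin d → MvPolynomial (Fin d) ℝ}

/-- The laws of the signal and noise coordinates. -/
def noiseCoordLaw (π : Measure ℝ) : ℕ ⊕ Sym2 ℕ → Measure ℝ :=
  Sum.elim (fun _ => π) fun e => gaussianReal 0 (if e.IsDiag then 2 else 1)

lemma finiteMoments_noiseCoordLaw {π : Measure ℝ}
    (hπ : ∀ k : ℕ, Integrable (fun x : ℝ => x ^ k) π) : FiniteMoments (noiseCoordLaw π) := by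
  rintro (i | e) k
  · exact hπ k
  · exact integrable_pow_gaussianReal _ k

/-- The coordinates of the model of dimension `n`. -/
def restrictCoord (n : ℕ) (ω : ℕ ⊕ Sym2 ℕ → ℝ) : (Fin n → ℝ) × (Sym2 (Fin n) → ℝ) :=
  (fun i => ω (Sum.inl i), fun e => ω (Sum.inr (e.map Fin.val)))

lemma measurable_restrictCoord (n : ℕ) : Measurable (restrictCoord n) := by
  unfold restrictCoord; fun_prop

/-- The node messages as polynomials. -/
def nodePoly (F : ℕ → Fin d → MvPolynomial (Fin d) ℝ) (n : ℕ) : ℕ → ℕ → Fin d → NoisePoly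
  | 0, _ => 0
  | t + 1, a => fun α =>
      (√(n : ℝ))⁻¹ • ∑ k ∈ Finset.range n \ {a}, obsPoly n a k * nonlinPoly F t n k a α

lemma eval_obsPoly (n : ℕ) (ω : ℕ ⊕ Sym2 ℕ → ℝ) (i k : Fin n) :
    MvPolynomial.eval ω (obsPoly n i k) =
      rankOneObs (restrictCoord n ω).1 (restrictCoord n ω).2 i k := by
  simp only [obsPoly, sigVar, noiVar, map_add, MvPolynomial.smul_eval, map_mul,
    MvPolynomial.eval_X, rankOneObs, restrictCoord, Matrix.of_apply, Sym2.map_mk]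
  rw [div_eq_inv_mul]

lemma sum_range_sdiff_eq {M : Type} [AddCommMonoid M] {n : ℕ} (s : Finset (Fin n)) (f : ℕ → M) :
    ∑ k ∈ Finset.range n \ s.map Fin.valEmbedding, f k = ∑ k ∈ Finset.univ \ s, f k := by
  refine Eq.trans ?_ (Finset.sum_map (Finset.univ \ s) Fin.valEmbedding f)
  congr 1
  ext k
  simp only [Finset.mem_sdiff, Finset.mem_range, Finset.mem_map, Finset.mem_univ, true_and,
    Fin.valEmbedding_apply, not_exists, not_and]
  constructor
  · rintro ⟨hk, h⟩
    exact ⟨⟨k, hk⟩, fun h' => h _ h' rfl, rfl⟩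
  · rintro ⟨i, hi, rfl⟩
    exact ⟨i.2, fun j hj hji => hi (Fin.ext hji ▸ hj)⟩

lemma eval_msgPoly (n : ℕ) (ω : ℕ ⊕ Sym2 ℕ → ℝ) (t : ℕ) (i j : Fin n) :
    (fun α => MvPolynomial.eval ω (msgPoly F t n i j α)) =
      edgeMsg F (rankOneObs (restrictCoord n ω).1 (restrictCoord n ω).2) t i j := by
  induction t generalizing i j with
  | zero => ext α; simp [msgPoly, edgeMsg]
  | succ t ih =>
    ext α
    rw [msgPoly_succ, msgStep, edgeMsg]
    by_cases hij : i = j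
    · simp [hij]
    · rw [if_neg (fun h => hij (Fin.ext h)), if_neg hij]
      have hset : ({(i : ℕ), (j : ℕ)} : Finset ℕ) = ({i, j} : Finset (Fin n)).map Fin.valEmbedding := by
        simp
      rw [hset, sum_range_sdiff_eq]
      simp only [MvPolynomial.smul_eval, map_sum, map_mul, eval_obsPoly, nonlinPoly,
        MvPolynomial.eval_aeval_apply, ih, Pi.smul_apply, Finset.sum_apply, smul_eq_mul, polyMap,
        one_div]

lemma eval_nodePoly (n : ℕ) (ω : ℕ ⊕ Sym2 ℕ → ℝ) (t : ℕ) (i : Fin n) :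
    (fun α => MvPolynomial.eval ω (nodePoly F n t i α)) =
      nodeMsg F (rankOneObs (restrictCoord n ω).1 (restrictCoord n ω).2) t i := by
  cases t with
  | zero => ext α; simp [nodePoly, nodeMsg]
  | succ t =>
    ext α
    have hset : ({(i : ℕ)} : Finset ℕ) = ({i} : Finset (Fin n)).map Fin.valEmbedding := by simp
    rw [nodePoly, nodeMsg]
    beta_reduce
    rw [hset, sum_range_sdiff_eq]
    simp only [MvPolynomial.smul_eval, map_sum, map_mul, eval_obsPoly, nonlinPoly,
      MvPolynomial.eval_aeval_apply, eval_msgPoly, Pi.smul_apply, Finset.sum_apply, smul_eq_mul,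
      polyMap, one_div]

lemma continuous_polyMap (f : Fin d → MvPolynomial (Fin d) ℝ) : Continuous (polyMap f) :=
  continuous_pi fun α => MvPolynomial.continuous_eval (f α)

lemma continuous_rankOneObs {n : ℕ} (i k : Fin n) :
    Continuous fun ω : (Fin n → ℝ) × (Sym2 (Fin n) → ℝ) => rankOneObs ω.1 ω.2 i k := by
  simp only [rankOneObs, Matrix.of_apply]
  fun_prop

lemma continuous_edgeMsg {n : ℕ} (t : ℕ) (i j : Fin n) :
    Continuous fun ω : (Fin n → ℝ) × (Sym2 (Fin n) → ℝ) =>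
      edgeMsg F (rankOneObs ω.1 ω.2) t i j := by
  induction t generalizing i j with
  | zero => exact continuous_const
  | succ t ih =>
    simp only [edgeMsg]
    split_ifs
    · exact continuous_const
    · refine Continuous.const_smul ?_ (1 / √(n : ℝ))
      exact continuous_finsetSum _ fun k _ => (continuous_rankOneObs i k).smul
        ((continuous_polyMap _).comp (ih k i))

lemma continuous_nodeMsg {n : ℕ} (t : ℕ) (i : Fin n) :
    Continuous fun ω : (Fin n → ℝ) × (Sym2 (Fin n) → ℝ) =>
      nodeMsg F (rankOneObs ω.1 ω.2) t i := by
  cases t with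
  | zero => exact continuous_const
  | succ t =>
    simp only [nodeMsg]
    refine Continuous.const_smul ?_ (1 / √(n : ℝ))
    exact continuous_finsetSum _ fun k _ => (continuous_rankOneObs i k).smul
      ((continuous_polyMap _).comp (continuous_edgeMsg t k i))

lemma continuous_testEval {X : Type} [TopologicalSpace X] (ψ : MvPolynomial (Fin d ⊕ Unit) ℝ)
    {x : X → Fin d → ℝ} {θ : X → ℝ} (hx : Continuous x) (hθ : Continuous θ) :
    Continuous fun ω => testEval ψ (x ω) (θ ω) := by
  unfold testEval
  refine (MvPolynomial.continuous_eval ψ).comp (continuous_pi ?_)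
  rintro (α | _)
  · exact (continuous_apply α).comp hx
  · exact hθ

/-- Polynomials are Lipschitz on bounded families: closeness of order `1 / N` passes from the
arguments to the values by telescoping products. -/
lemma momentBdd_aeval_sub {mom : ℕ → ℝ} {E : NoisePoly →ₗ[ℝ] ℝ} (hE : IsNoiseExpectation mom E)
    {ι σ : Type} (N : ι → ℝ) {u v : ι → σ → NoisePoly}
    (hu : ∀ s, MomentBdd E (Set.range fun i => u i s))
    (hv : ∀ s, MomentBdd E (Set.range fun i => v i s))
    (huv : ∀ s, MomentBdd E (Set.range fun i => N i • (u i s - v i s))) (φ : MvPolynomial σ ℝ) :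
    MomentBdd E (Set.range fun i => MvPolynomial.aeval (v i) φ) ∧
    MomentBdd E (Set.range fun i => N i • (MvPolynomial.aeval (u i) φ -
      MvPolynomial.aeval (v i) φ)) := by
  induction φ using MvPolynomial.induction_on with
  | C r =>
    refine ⟨(MomentBdd.singleton (MvPolynomial.C r)).mono ?_, (MomentBdd.singleton 0).mono ?_⟩
    · rintro _ ⟨i, rfl⟩; simp
    · rintro _ ⟨i, rfl⟩; simp
  | add p q hp hq =>
    refine ⟨(hp.1.add hE hq.1).mono ?_, (hp.2.add hE hq.2).mono ?_⟩
    · rintro _ ⟨i, rfl⟩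
      simp only [map_add]
      exact Set.add_mem_add ⟨i, rfl⟩ ⟨i, rfl⟩
    · rintro _ ⟨i, rfl⟩
      simp only [map_add, add_sub_add_comm, smul_add]
      exact Set.add_mem_add ⟨i, rfl⟩ ⟨i, rfl⟩
  | mul_X p s hp =>
    refine ⟨(hp.1.mul hE (hv s)).mono ?_,
      ((hp.2.mul hE (hu s)).add hE (hp.1.mul hE (huv s))).mono ?_⟩
    · rintro _ ⟨i, rfl⟩
      simp only [map_mul, MvPolynomial.aeval_X]
      exact Set.mul_mem_mul ⟨i, rfl⟩ ⟨i, rfl⟩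
    · rintro _ ⟨i, rfl⟩
      have : N i • (MvPolynomial.aeval (u i) (p * MvPolynomial.X s) -
          MvPolynomial.aeval (v i) (p * MvPolynomial.X s)) =
          (N i • (MvPolynomial.aeval (u i) p - MvPolynomial.aeval (v i) p)) * u i s +
          MvPolynomial.aeval (v i) p * (N i • (u i s - v i s)) := by
        simp only [map_mul, MvPolynomial.aeval_X, MvPolynomial.smul_eq_C_mul]
        ring
      simp only [this]
      exact Set.add_mem_add (Set.mul_mem_mul ⟨i, rfl⟩ ⟨i, rfl⟩)
        (Set.mul_mem_mul ⟨i, rfl⟩ ⟨i, rfl⟩)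

/-- A node message differs from an edge message by one term. -/
lemma nodePoly_sub_msgPoly (t : ℕ) {n a b : ℕ} (hb : b < n) (hab : a ≠ b) (α : Fin d) :
    nodePoly F n (t + 1) a α - msgPoly F (t + 1) n a b α =
      (√(n : ℝ))⁻¹ • (obsPoly n a b * nonlinPoly F t n b a α) := by
  have h : Finset.range n \ {a} = insert b (Finset.range n \ {a, b}) := by
    ext k
    simp only [Finset.mem_sdiff, Finset.mem_range, Finset.mem_singleton, Finset.mem_insert]
    by_cases hk : k = b
    · subst hk; simp [hb, hab.symm]
    · simp [hk]
  rw [nodePoly, msgPoly_succ, msgStep, if_neg hab]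
  beta_reduce
  rw [h, Finset.sum_insert (by simp), ← smul_sub, add_sub_cancel_right]

/-- Node messages and edge messages have the same limits. -/
lemma tendsto_expect_nodePoly_sub {mom : ℕ → ℝ} {E : NoisePoly →ₗ[ℝ] ℝ}
    (hE : IsNoiseExpectation mom E) (t : ℕ) (φ : MvPolynomial (Fin d ⊕ Unit) ℝ) :
    Tendsto (fun n => E (MvPolynomial.aeval
      (Sum.elim (nodePoly F (n + 2) t 0) fun _ => sigVar 0) φ) - E (testPoly F t φ (n + 2) 0 1))
      atTop (𝓝 0) := by
  have hv : ∀ s, MomentBdd E (Set.range fun n : ℕ =>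
      Sum.elim (msgPoly F t (n + 2) 0 1) (fun _ : Unit => sigVar 0) s) := by
    rintro (α | _)
    · refine (weightBdd_msgPoly hE F t α).momentBdd_range.mono ?_
      rintro _ ⟨n, rfl⟩
      exact ⟨n + 2, 0, 1, by omega, rfl⟩
    · refine hE.momentBdd_sigVar.mono ?_
      rintro _ ⟨n, rfl⟩
      exact ⟨0, rfl⟩
  have huv : ∀ s, MomentBdd E (Set.range fun n : ℕ => √((n + 2 : ℕ) : ℝ) •
      (Sum.elim (nodePoly F (n + 2) t 0) (fun _ : Unit => sigVar 0) s -
        Sum.elim (msgPoly F t (n + 2) 0 1) (fun _ : Unit => sigVar 0) s)) := by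
    rintro (α | _)
    · cases t with
      | zero =>
        refine (MomentBdd.singleton 0).mono ?_
        rintro _ ⟨n, rfl⟩
        simp [nodePoly, msgPoly]
      | succ t =>
        refine (hE.momentBdd_obsPoly.mul hE
          (weightBdd_nonlinPoly hE F t α).momentBdd_range).mono ?_
        rintro _ ⟨n, rfl⟩
        have h0 : √((n + 2 : ℕ) : ℝ) ≠ 0 := by positivity
        simp only [Sum.elim_inl]
        rw [nodePoly_sub_msgPoly t (by omega) (by omega), smul_smul, mul_inv_cancel₀ h0, one_smul]
        exact Set.mul_mem_mul ⟨n + 2, 0, 1, by omega, by omega, rfl⟩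
          ⟨n + 2, 1, 0, by omega, rfl⟩
    · refine (MomentBdd.singleton 0).mono ?_
      rintro _ ⟨n, rfl⟩
      simp
  have hu : ∀ s, MomentBdd E (Set.range fun n : ℕ =>
      Sum.elim (nodePoly F (n + 2) t 0) (fun _ : Unit => sigVar 0) s) := by
    intro s
    refine ((hv s).add hE ((huv s).smul hE 1)).mono ?_
    rintro _ ⟨n, rfl⟩
    refine ⟨_, ⟨n, rfl⟩, _, ⟨(√((n + 2 : ℕ) : ℝ))⁻¹, _, ⟨n, rfl⟩, ?_, rfl⟩, ?_⟩
    · rw [abs_of_nonneg (by positivity)]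
      exact inv_le_one_of_one_le₀ (one_le_sqrt_natCast (by omega))
    · have h0 : √((n + 2 : ℕ) : ℝ) ≠ 0 := by positivity
      simp only [smul_smul, inv_mul_cancel₀ h0, one_smul]
      abel
  obtain ⟨C, -, hC⟩ := (momentBdd_aeval_sub hE (fun n : ℕ => √((n + 2 : ℕ) : ℝ)) hu hv huv
    φ).2.abs_expect_le hE
  have hlim : Tendsto (fun n : ℕ => (√((n + 2 : ℕ) : ℝ))⁻¹) atTop (𝓝 0) :=
    (Real.tendsto_sqrt_atTop.comp (tendsto_natCast_atTop_atTop.comp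
      (tendsto_add_atTop_nat 2))).inv_tendsto_atTop
  have hlim' : Tendsto (fun n : ℕ => C * (√((n + 2 : ℕ) : ℝ))⁻¹) atTop (𝓝 0) := by
    have := hlim.const_mul C
    rwa [mul_zero] at this
  refine squeeze_zero_norm (fun n => ?_) hlim'
  have h1 := hC _ ⟨n, rfl⟩
  have h0 : 0 < √((n + 2 : ℕ) : ℝ) := by positivity
  rw [map_smul, smul_eq_mul, abs_mul, abs_of_pos h0, map_sub] at h1
  rw [Real.norm_eq_abs, ← div_eq_mul_inv, le_div_iff₀ h0, mul_comm]
  exact h1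

/-! ### Transfer of the limits to the models of each dimension. -/

variable {π : Measure ℝ} [IsProbabilityMeasure π]

instance (v : ℕ ⊕ Sym2 ℕ) : IsProbabilityMeasure (noiseCoordLaw π v) := by
  rcases v with i | e
  · exact inferInstanceAs (IsProbabilityMeasure π)
  · exact inferInstanceAs (IsProbabilityMeasure (gaussianReal 0 _))

lemma isNoiseExpectation_polyExpect (hπ : ∀ k : ℕ, Integrable (fun x : ℝ => x ^ k) π) :
    IsNoiseExpectation (fun k => ∫ x, x ^ k ∂π)
      (polyExpect (finiteMoments_noiseCoordLaw hπ)) where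
  nonneg := polyExpect_nonneg _
  one := polyExpect_one _
  ibp e he f := by
    refine polyExpect_X_mul _ ?_ f
    simp [noiseCoordLaw, he]
  indep i j hij k l := polyExpect_X_pow_mul _ (by simpa using hij) k l

/-- All dimensions are coupled as coordinate restrictions of one infinite product, so that a single
expectation functional suffices. -/
lemma rankOneLaw_eq_map (n : ℕ) :
    rankOneLaw π n = (Measure.infinitePi (noiseCoordLaw π)).map (restrictCoord n) := by
  let f : Fin n ⊕ Sym2 (Fin n) → ℕ ⊕ Sym2 ℕ := Sum.map Fin.val (Sym2.map Fin.val)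
  have hf : Function.Injective f :=
    Sum.map_injective.2 ⟨Fin.val_injective, Sym2.map.injective Fin.val_injective⟩
  have h1 := Measure.map_infinitePi_infinitePi_of_inj (P := noiseCoordLaw π) hf
  rw [Measure.infinitePi_eq_pi (μ := fun v => noiseCoordLaw π (f v))] at h1
  have h2 := measurePreserving_sumPiEquivProdPi fun v => noiseCoordLaw π (f v)
  have h3 : rankOneLaw π n = (Measure.pi fun i : Fin n => noiseCoordLaw π (f (Sum.inl i))).prod
      (Measure.pi fun e : Sym2 (Fin n) => noiseCoordLaw π (f (Sum.inr e))) := by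
    rw [rankOneLaw, goeLaw]
    congr 2
    ext1 e
    simp only [f, noiseCoordLaw, Sum.map_inr, Sum.elim_inr]
    congr 1
    induction e using Sym2.ind with
    | _ i j => simp [Fin.ext_iff]
  rw [h3, ← h2.map_eq, ← h1, Measure.map_map (by fun_prop) (by fun_prop)]
  rfl

/-- Transfer of a limit of polynomial expectations to the finite-dimensional models. -/
lemma expectationTendsto_of_poly (hπ : ∀ k : ℕ, Integrable (fun x : ℝ => x ^ k) π)
    (t : ℕ) (φ : MvPolynomial (Fin d ⊕ Unit) ℝ)
    {X : ∀ n : ℕ, (Fin (n + 2) → ℝ) × (Sym2 (Fin (n + 2)) → ℝ) → ℝ}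
    (hX : ∀ n, Continuous (X n)) {L : ℝ × EuclideanSpace ℝ (Fin d) → ℝ}
    (hL : ∀ p, L p = testEval φ (seVec π F t p) p.1) (f : ℕ → NoisePoly)
    (hf : ∀ n ω, MvPolynomial.eval ω (f n) = X n (restrictCoord (n + 2) ω))
    (hlim : Tendsto (fun n => polyExpect (finiteMoments_noiseCoordLaw hπ) (f n)) atTop
      (𝓝 (seExpect hπ F t φ))) :
    ExpectationTendsto (fun n => rankOneLaw π (n + 2)) X (seLaw π F t) L := by
  obtain rfl : L = fun p => testEval φ (seVec π F t p) p.1 := funext hL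
  refine ⟨fun n => ?_, integrable_testEval_seVec hπ t φ, ?_⟩
  · change Integrable (X n) (rankOneLaw π (n + 2))
    rw [rankOneLaw_eq_map, integrable_map_measure (hX n).aestronglyMeasurable
      (measurable_restrictCoord _).aemeasurable]
    exact ((finiteMoments_noiseCoordLaw hπ).integrable_eval (f n)).congr
      (ae_of_all _ fun ω => hf n ω)
  · rw [integral_testEval_seVec hπ]
    refine hlim.congr fun n => ?_
    change _ = ∫ ω, X n ω ∂(rankOneLaw π (n + 2))
    rw [rankOneLaw_eq_map, integral_map (measurable_restrictCoord _).aemeasurable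
      (hX n).aestronglyMeasurable, polyExpect_apply]
    simp only [hf]

/-- The pair limit with the constant `1` as second test polynomial; `1 → 0` serves as a dummy second
message with a different source. -/
lemma tendsto_expect_testPoly (hπ : ∀ k : ℕ, Integrable (fun x : ℝ => x ^ k) π)
    (t : ℕ) (φ : MvPolynomial (Fin d ⊕ Unit) ℝ) :
    Tendsto (fun n => polyExpect (finiteMoments_noiseCoordLaw hπ) (testPoly F t φ (n + 2) 0 1))
      atTop (𝓝 (seExpect hπ F t φ)) := by
  have h := pairLimit_seExpect (F := F) (isNoiseExpectation_polyExpect hπ) hπ t φ 1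
  rw [(isLimitLaw_seExpect hπ t).one, mul_one] at h
  have h1 : Tendsto (fun n : ℕ => (⟨n + 2, 0, 1, 1, 0, by omega, by omega, by omega, by omega,
      by omega, by omega, by omega⟩ : PairIdx)) atTop PairIdx.large :=
    tendsto_comap_iff.2 (tendsto_add_atTop_nat 2)
  refine (h.comp h1).congr fun n => ?_
  simp [testPoly]

lemma tendsto_expect_nodePoly (hπ : ∀ k : ℕ, Integrable (fun x : ℝ => x ^ k) π)
    (t : ℕ) (φ : MvPolynomial (Fin d ⊕ Unit) ℝ) :
    Tendsto (fun n => polyExpect (finiteMoments_noiseCoordLaw hπ) (MvPolynomial.aeval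
      (Sum.elim (nodePoly F (n + 2) t 0) fun _ => sigVar 0) φ))
      atTop (𝓝 (seExpect hπ F t φ)) := by
  have h := (tendsto_expect_nodePoly_sub (F := F) (isNoiseExpectation_polyExpect hπ) t φ).add
    (tendsto_expect_testPoly (F := F) hπ t φ)
  simpa using h

/-- Composition of a test polynomial with a polynomial map in the first argument. -/
def compTest (f : Fin d → MvPolynomial (Fin d) ℝ) (ψ : MvPolynomial (Fin d ⊕ Unit) ℝ) :
    MvPolynomial (Fin d ⊕ Unit) ℝ :=
  MvPolynomial.aeval (Sum.elim (fun α => liftTest (f α)) fun _ => sigTest) ψ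

lemma testEval_compTest (f : Fin d → MvPolynomial (Fin d) ℝ) (ψ : MvPolynomial (Fin d ⊕ Unit) ℝ)
    (x : Fin d → ℝ) (θ : ℝ) : testEval (compTest f ψ) x θ = testEval ψ (polyMap f x) θ := by
  rw [testEval, compTest, MvPolynomial.eval_aeval_apply, testEval]
  congr 2
  ext v
  rcases v with α | _
  · exact testEval_liftTest (f α) x θ
  · exact testEval_sigTest x θ

lemma eval_aeval_sum_elim (ω : ℕ ⊕ Sym2 ℕ → ℝ) (m : Fin d → NoisePoly) (a : ℕ)
    (φ : MvPolynomial (Fin d ⊕ Unit) ℝ) :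
    MvPolynomial.eval ω (MvPolynomial.aeval (Sum.elim m fun _ => sigVar a) φ) =
      testEval φ (fun α => MvPolynomial.eval ω (m α)) (ω (Sum.inl a)) := by
  rw [MvPolynomial.eval_aeval_apply, testEval]
  congr 2
  ext v
  rcases v with α | _
  · rfl
  · simp [sigVar]

lemma expectationTendsto_nodeMsg (hπ : ∀ k : ℕ, Integrable (fun x : ℝ => x ^ k) π)
    (t : ℕ) (φ : MvPolynomial (Fin d ⊕ Unit) ℝ) :
    ExpectationTendsto (fun n => rankOneLaw π (n + 2))
      (fun _ ω => testEval φ (nodeMsg F (rankOneObs ω.1 ω.2) t 0) (ω.1 0))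
      (seLaw π F t) (fun p => testEval φ (seVec π F t p) p.1) := by
  refine expectationTendsto_of_poly hπ t φ (fun n => continuous_testEval φ
    (continuous_nodeMsg t 0) (by fun_prop)) (fun _ => rfl) _ (fun n ω => ?_)
    (tendsto_expect_nodePoly hπ t φ)
  rw [eval_aeval_sum_elim]
  exact congrArg (fun x => testEval φ x (ω (Sum.inl 0)))
    (eval_nodePoly (F := F) (n + 2) ω t 0)

lemma expectationTendsto_edgeMsg (hπ : ∀ k : ℕ, Integrable (fun x : ℝ => x ^ k) π)
    (t : ℕ) (φ : MvPolynomial (Fin d ⊕ Unit) ℝ) :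
    ExpectationTendsto (fun n => rankOneLaw π (n + 2))
      (fun _ ω => testEval φ (edgeMsg F (rankOneObs ω.1 ω.2) t 0 1) (ω.1 0))
      (seLaw π F t) (fun p => testEval φ (seVec π F t p) p.1) := by
  refine expectationTendsto_of_poly hπ t φ (fun n => continuous_testEval φ
    (continuous_edgeMsg t 0 1) (by fun_prop)) (fun _ => rfl) _ (fun n ω => ?_)
    (tendsto_expect_testPoly hπ t φ)
  rw [testPoly, eval_aeval_sum_elim]
  exact congrArg (fun x => testEval φ x (ω (Sum.inl 0)))
    (eval_msgPoly (F := F) (n + 2) ω t 0 1)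

end Model

end
/-- The dimension is written `n + 2`, so that the first two indices `1, 2` (here `0, 1`) exist.
The fourth and fifth clauses are the limits of `E ψ(F_t(m^t_1), θ_1)` and
`E ψ(F_t(m^{t+1}_1), θ_1)`. -/
theorem lemma4p10 (π : Measure ℝ) [IsProbabilityMeasure π]
    (hπ : ∀ k : ℕ, Integrable (fun x : ℝ => x ^ k) π)
    (d : ℕ) (F : ℕ → Fin d → MvPolynomial (Fin d) ℝ)
    (t : ℕ) (ψ : MvPolynomial (Fin d ⊕ Unit) ℝ) :
    (seCov π F t).PosSemidef ∧
    ExpectationTendsto (fun n => rankOneLaw π (n + 2))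
      (fun _ ω => testEval ψ (edgeMsg F (rankOneObs ω.1 ω.2) t 0 1) (ω.1 0))
      (seLaw π F t) (fun p => testEval ψ (seVec π F t p) p.1) ∧
    ExpectationTendsto (fun n => rankOneLaw π (n + 2))
      (fun _ ω => testEval ψ (nodeMsg F (rankOneObs ω.1 ω.2) t 0) (ω.1 0))
      (seLaw π F t) (fun p => testEval ψ (seVec π F t p) p.1) ∧
    ExpectationTendsto (fun n => rankOneLaw π (n + 2))
      (fun _ ω => testEval ψ (polyMap (F t) (nodeMsg F (rankOneObs ω.1 ω.2) t 0)) (ω.1 0))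
      (seLaw π F t) (fun p => testEval ψ (polyMap (F t) (seVec π F t p)) p.1) ∧
    ExpectationTendsto (fun n => rankOneLaw π (n + 2))
      (fun _ ω => testEval ψ (polyMap (F t) (nodeMsg F (rankOneObs ω.1 ω.2) (t + 1) 0)) (ω.1 0))
      (seLaw π F (t + 1))
      (fun p => testEval ψ (polyMap (F t) (seVec π F (t + 1) p)) p.1) := by
  refine ⟨posSemidef_seCov hπ t, expectationTendsto_edgeMsg hπ t ψ,
    expectationTendsto_nodeMsg hπ t ψ, ?_, ?_⟩
  -- Composing `ψ` with the polynomial map `F t` gives another test polynomial, to which the limit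
  -- for node messages applies.
  · simpa only [testEval_compTest] using
      expectationTendsto_nodeMsg (F := F) hπ t (compTest (F t) ψ)
  · simpa only [testEval_compTest] using
      expectationTendsto_nodeMsg (F := F) hπ (t + 1) (compTest (F t) ψ)
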